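/- Let $d\ge 1$, let $X_1,X_2,\dots$ be i.i.d. $\mathbb{Z}^d$-valued random variables (with an arbitrary common law), let $S_0\in\mathbb{Z}^d$ be a constant and $S_k=S_0+\sum_{i=1}^k X_i$. Let $\mathcal N(a)$ denote the set of the $2d$ nearest neighbours of $a\in\mathbb{Z}^d$, that is, of the points at Euclidean distance $1$ from $a$. For $n\ge 0$ let $$H_n=\{S_i:\ 0\le i\le n,\ \{S_m\}_{m=0}^n\not\supset\mathcal N(S_i)\}$$ be the inner boundary of the range $\{S_m\}_{m=0}^n$ and, for an integer $p\ge 1$, let $$J_n^{(p)}=\sharp\{x\in H_n:\ \sharp\{m:0\le m\le n,\ S_m=x\}=p\},\qquad J_n^{p}=\sharp\{x\in H_n:\ \sharp\{m:0\le m\le n,\ S_m=x\}\ge p\}.$$ Let $\widetilde S,S^1,\dots,S^{p-1}$ and $S'$ be independent processes, where $\widetilde S,S^1,\dots,S^{p-1}$ are copies of the walk $(S_m-S_0)_{m\ge 0}$ started from $0$, and the dual walk $S'$ is a copy of $(-(S_m-S_0))_{m\ge 0}$. Put $T_{0,i}=\inf\{m\ge 1: S^i_m=0\}$, with $\inf\emptyset=\infty$.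 Then, almost surely, $$\lim_{n\to\infty}\frac{J_n^{(p)}}{n}=P\Big(\{\widetilde S_m\}_{m\ge0}\cup\{S'_m\}_{m\ge0}\cup\bigcup_{i=1}^{p-1}\{S^i_m\}_{0\le m\le T_{0,i}}\not\supset\mathcal N(0),\ 0\notin\{\widetilde S_m\}_{m\ge1}\cup\{S'_m\}_{m\ge1},\ 0\in\{S^i_m\}_{m\ge1}\text{ for }i=1,\dots,p-1\Big)$$ and, almost surely, $$\lim_{n\to\infty}\frac{J_n^{p}}{n}=P\Big(\{\widetilde S_m\}_{m\ge0}\cup\{S'_m\}_{m\ge0}\cup\bigcup_{i=1}^{p-1}\{S^i_m\}_{0\le m\le T_{0,i}}\not\supset\mathcal N(0),\ 0\notin\{\widetilde S_m\}_{m\ge1},\ 0\in\{S^i_m\}_{m\ge1}\text{ for }i=1,\dots,p-1\Big).$$ -/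

import Mathlib

open MeasureTheory ProbabilityTheory Filter Topology

/-- The integer lattice `ℤ^d`. -/
abbrev IntLattice (d : ℕ) : Type := Fin d → ℤ

/-- A trajectory `s 0, s 1, s 2, …` in `ℤ^d`. -/
abbrev Trajectory (d : ℕ) : Type := ℕ → IntLattice d

/-- The `2d` nearest neighbours of `a`. The distance is written out as the `ℓ¹` distance, because
the `dist` that Mathlib puts on `Fin d → ℤ` is the supremum distance; on the lattice, the points at
`ℓ¹` distance one are the points at Euclidean distance one. -/
def neighbors {d : ℕ} (a : IntLattice d) : Set (IntLattice d) :=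
  {z | ∑ j, |z j - a j| = 1}

/-- The walk `S_k = a + X_1 + ⋯ + X_k` started from `a`; the step `X_{i+1}` is `X i`. -/
def randomWalk {d : ℕ} {Ω : Type*} (a : IntLattice d) (X : ℕ → Ω → IntLattice d) (ω : Ω) :
    Trajectory d :=
  fun k => a + ∑ i ∈ Finset.range k, X i ω

/-- The inner boundary of the range `{s 0, …, s n}`: the visited points with at least one
neighbour that has not been visited. -/
def innerBoundary {d : ℕ} (s : Trajectory d) (n : ℕ) : Set (IntLattice d) :=
  {x | x ∈ s '' Set.Iic n ∧ ¬ neighbors x ⊆ s '' Set.Iic n}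

/-- The number of visits of `s 0, …, s n` to `x`. -/
noncomputable def visits {d : ℕ} (s : Trajectory d) (n : ℕ) (x : IntLattice d) : ℕ :=
  {m : ℕ | m ≤ n ∧ s m = x}.ncard

/-- The number of inner boundary points visited exactly `p` times in the first `n` steps. -/
noncomputable def countExactly {d : ℕ} (s : Trajectory d) (p n : ℕ) : ℕ :=
  {x | x ∈ innerBoundary s n ∧ visits s n x = p}.ncard

/-- The number of inner boundary points visited at least `p` times in the first `n` steps. -/
noncomputable def countAtLeast {d : ℕ} (s : Trajectory d) (p n : ℕ) : ℕ :=
  {x | x ∈ innerBoundary s n ∧ p ≤ visits s n x}.ncard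

/-- The passage time `inf {m ≥ 1 : s m = a}`, which is `⊤` if there is no such `m`. -/
noncomputable def passageTime {d : ℕ} (s : Trajectory d) (a : IntLattice d) : ℕ∞ :=
  sInf ((fun m : ℕ => (m : ℕ∞)) '' {m : ℕ | 1 ≤ m ∧ s m = a})

/-- The points `s 0, …, s T`, where `T` is the passage time to the origin. -/
def excursionRange {d : ℕ} (s : Trajectory d) : Set (IntLattice d) :=
  s '' {m : ℕ | (m : ℕ∞) ≤ passageTime s 0}

/-- The set `{s 1, s 2, …}`. -/
def futureRange {d : ℕ} (s : Trajectory d) : Set (IntLattice d) :=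
  s '' Set.Ici 1

/-- The whole of the forward walk `s`, the dual walk `s'` and the excursions `e i` does not
cover the neighbours of the origin. -/
def NotCovered {d k : ℕ} (s s' : Trajectory d) (e : Fin k → Trajectory d) : Prop :=
  ¬ neighbors (0 : IntLattice d) ⊆ Set.range s ∪ Set.range s' ∪ ⋃ i, excursionRange (e i)

/-- The event whose probability is the limit for points visited exactly `k + 1` times. -/
def exactEvent (d k : ℕ) : Set (Trajectory d × Trajectory d × (Fin k → Trajectory d)) :=
  {w | NotCovered w.1 w.2.1 w.2.2 ∧
    (0 : IntLattice d) ∉ futureRange w.1 ∪ futureRange w.2.1 ∧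
    ∀ i, (0 : IntLattice d) ∈ futureRange (w.2.2 i)}

/-- The event whose probability is the limit for points visited at least `k + 1` times. -/
def atLeastEvent (d k : ℕ) : Set (Trajectory d × Trajectory d × (Fin k → Trajectory d)) :=
  {w | NotCovered w.1 w.2.1 w.2.2 ∧
    (0 : IntLattice d) ∉ futureRange w.1 ∧
    ∀ i, (0 : IntLattice d) ∈ futureRange (w.2.2 i)}

/-- The law on trajectory space of the walk started from the origin. -/
noncomputable def walkLaw {d : ℕ} {Ω : Type*} [MeasurableSpace Ω] (P : Measure Ω)
    (X : ℕ → Ω → IntLattice d) : Measure (Trajectory d) :=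
  P.map (fun ω => randomWalk 0 X ω)

/-- The law on trajectory space of the dual walk, the negative of the walk from the origin. -/
noncomputable def dualLaw {d : ℕ} {Ω : Type*} [MeasurableSpace Ω] (P : Measure Ω)
    (X : ℕ → Ω → IntLattice d) : Measure (Trajectory d) :=
  P.map (fun ω => -randomWalk 0 X ω)

/-- The joint law of independent copies of the walk `S`, of the dual walk `S'` and of `k` further
walks `S^1, …, S^k`, all started from the origin. -/
noncomputable def jointLaw {d : ℕ} {Ω : Type*} [MeasurableSpace Ω] (P : Measure Ω)
    (X : ℕ → Ω → IntLattice d) (k : ℕ) :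
    Measure (Trajectory d × Trajectory d × (Fin k → Trajectory d)) :=
  (walkLaw P X).prod ((dualLaw P X).prod (Measure.pi fun _ : Fin k => walkLaw P X))

/-! Put `k = p - 1`. An inner boundary point visited at least `p` times up to `n` has exactly one
`p`-th last visit, so `countAtLeast` counts the times `i ≤ n` that are such visits. Seen from `S_i`,
this says that the future returns to `0` exactly `k` times in `n - i` steps, and that this future
and the `i` reversed steps of the past together miss a neighbour of `0`. For exactly `p` visits, the
reversed past must moreover avoid `0`.

Extend the steps to an i.i.d. sequence indexed by `ℤ`. The condition becomes an event `E (n - i) i`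
for the sequence shifted by `i`, and `E u v` stabilises pointwise to a limit event as `u` and `v`
grow, because there are finitely many neighbours and the number of returns is monotone. The
sequences on which stabilisation has not occurred by `k` form a set whose measure tends to `0`.
Birkhoff's theorem for the ergodic shift (`ergodic_intShift`) therefore gives the frequency of the
limit event (`ae_tendsto_card_window_div`).

The probability of that event is then put in the required form. The two halves of the sequence give
independent forward and dual walks (`map_twoSidedWalk`), and repeated use of the Markov property at
the first return cuts a forward walk with exactly `k` returns into `k` independent excursions and a
final walk that never returns (`stepLaw_returnsNotCovered`). -/

/-! ### Birkhoff's ergodic theorem and frequencies of window events -/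

section Birkhoff

variable {α : Type*}

/-- The maximum of `0` and the first `n` Birkhoff sums of `g`. -/
noncomputable def maxBirkhoffSum (T : α → α) (g : α → ℝ) : ℕ → α → ℝ
  | 0, _ => 0
  | n + 1, x => max 0 (g x + maxBirkhoffSum T g n (T x))

lemma maxBirkhoffSum_nonneg (T : α → α) (g : α → ℝ) (n : ℕ) (x : α) :
    0 ≤ maxBirkhoffSum T g n x := by
  cases n with
  | zero => exact le_rfl
  | succ n => exact le_max_left _ _

lemma maxBirkhoffSum_le_succ (T : α → α) (g : α → ℝ) (n : ℕ) (x : α) :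
    maxBirkhoffSum T g n x ≤ maxBirkhoffSum T g (n + 1) x := by
  induction n generalizing x with
  | zero => exact le_max_left _ _
  | succ n ih => exact max_le_max le_rfl (add_le_add le_rfl (ih _))

lemma birkhoffSum_le_maxBirkhoffSum (T : α → α) (g : α → ℝ) (n : ℕ) (x : α) :
    birkhoffSum T g n x ≤ maxBirkhoffSum T g n x := by
  induction n generalizing x with
  | zero => simp [maxBirkhoffSum]
  | succ n ih =>
    rw [birkhoffSum_succ']
    exact (add_le_add le_rfl (ih _)).trans (le_max_right _ _)

/-- Supplies the dominating function for the passage to the limit in `ae_exists_birkhoffSum_le`. -/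
lemma abs_maxBirkhoffSum_succ_sub_le (T : α → α) (g : α → ℝ) (n : ℕ) (x : α) :
    |maxBirkhoffSum T g (n + 1) x - maxBirkhoffSum T g n (T x)| ≤ |g x| := by
  have h := maxBirkhoffSum_nonneg T g n (T x)
  simp only [maxBirkhoffSum]
  rw [abs_le]
  rcases max_cases 0 (g x + maxBirkhoffSum T g n (T x)) with h' | h' <;>
    constructor <;> linarith [neg_abs_le (g x), le_abs_self (g x), abs_nonneg (g x)]

variable [MeasurableSpace α] {μ : Measure α} {T : α → α} {g : α → ℝ}

lemma integrable_maxBirkhoffSum (hT : MeasurePreserving T μ μ) (hg : Integrable g μ) (n : ℕ) :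
    Integrable (maxBirkhoffSum T g n) μ := by
  induction n with
  | zero => exact integrable_zero _ _ _
  | succ n ih =>
    exact (integrable_zero _ _ _).sup (hg.add (hT.integrable_comp_of_integrable ih))

lemma measurable_birkhoffSum (hT : Measurable T) (hg : Measurable g) (n : ℕ) :
    Measurable (birkhoffSum T g n) :=
  Finset.measurable_sum _ fun i _ => hg.comp (hT.iterate i)

/-- The Birkhoff sums of a function with negative integral are almost surely bounded above. -/
lemma ae_exists_birkhoffSum_le [IsFiniteMeasure μ] (hT : Ergodic T μ) (hgm : Measurable g)
    (hg : Integrable g μ) (hneg : ∫ x, g x ∂μ < 0) :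
    ∀ᵐ x ∂μ, ∃ K : ℕ, ∀ n, birkhoffSum T g n x ≤ K := by
  set U : Set α := {x | ∀ K : ℕ, ∃ n, (K : ℝ) < birkhoffSum T g n x} with hU
  have hUm : MeasurableSet U := by
    simp only [hU, Set.ofPred_forall, Set.ofPred_exists]
    exact .iInter fun K => .iUnion fun n =>
      measurableSet_lt measurable_const (measurable_birkhoffSum hT.measurable hgm n)
  have hUinv : T ⁻¹' U = U := by
    ext x
    simp only [hU, Set.mem_preimage, Set.mem_ofPred_eq]
    constructor
    · intro h K
      obtain ⟨K', hK'⟩ := exists_nat_ge ((K : ℝ) - g x)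
      obtain ⟨n, hn⟩ := h K'
      exact ⟨n + 1, by rw [birkhoffSum_succ']; linarith⟩
    · intro h K
      obtain ⟨K', hK'⟩ := exists_nat_ge ((K : ℝ) + g x)
      obtain ⟨n, hn⟩ := h K'
      cases n with
      | zero =>
        rw [birkhoffSum_zero] at hn
        exact absurd hn (not_lt.2 (Nat.cast_nonneg _))
      | succ n =>
        rw [birkhoffSum_succ'] at hn
        exact ⟨n, by linarith⟩
  rcases hT.ae_mem_or_ae_notMem hUm hUinv with h | h
  -- If the sums are unbounded above almost surely, then `M_{n+1} - M_n ∘ T` is eventually equal to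
  -- `g`, where `M_n` is `maxBirkhoffSum`. Its integral is nonnegative since `M_n` increases and `T`
  -- preserves `μ`, so dominated convergence forces `∫ g ≥ 0`.
  · exfalso
    have hlim : Tendsto
        (fun n => ∫ x, (maxBirkhoffSum T g (n + 1) x - maxBirkhoffSum T g n (T x)) ∂μ) atTop
        (𝓝 (∫ x, g x ∂μ)) := by
      refine tendsto_integral_of_dominated_convergence (fun x => |g x|) (fun n => ?_) hg.abs
        (fun n => Eventually.of_forall fun x => ?_) ?_
      · exact ((integrable_maxBirkhoffSum hT.toMeasurePreserving hg _).sub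
          (hT.toMeasurePreserving.integrable_comp_of_integrable
            (integrable_maxBirkhoffSum hT.toMeasurePreserving hg n))).aestronglyMeasurable
      · simpa using abs_maxBirkhoffSum_succ_sub_le T g n x
      · filter_upwards [h] with x hx
        have hx' : T x ∈ U := by rw [← hUinv] at hx; exact hx
        obtain ⟨K, hK⟩ := exists_nat_ge (-g x)
        obtain ⟨N, hN⟩ := hx' K
        refine tendsto_const_nhds.congr' ?_
        filter_upwards [eventually_ge_atTop N] with n hn
        have h1 := (birkhoffSum_le_maxBirkhoffSum T g N (T x)).trans
          (monotone_nat_of_le_succ (fun k => maxBirkhoffSum_le_succ T g k (T x)) hn)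
        simp only [maxBirkhoffSum]
        rw [max_eq_right (by linarith)]
        ring
    have hnonneg : ∀ n,
        0 ≤ ∫ x, (maxBirkhoffSum T g (n + 1) x - maxBirkhoffSum T g n (T x)) ∂μ := by
      intro n
      have i1 := integrable_maxBirkhoffSum hT.toMeasurePreserving hg (n + 1)
      have i2 := integrable_maxBirkhoffSum hT.toMeasurePreserving hg n
      have h2 : ∫ x, maxBirkhoffSum T g n (T x) ∂μ = ∫ x, maxBirkhoffSum T g n x ∂μ := by
        rw [← integral_map hT.measurable.aemeasurable (by rw [hT.map_eq]; exact i2.1), hT.map_eq]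
      have h3 : Integrable (fun x => maxBirkhoffSum T g n (T x)) μ :=
        hT.toMeasurePreserving.integrable_comp_of_integrable i2
      rw [integral_sub i1 h3, h2, sub_nonneg]
      exact integral_mono i2 i1 fun x => maxBirkhoffSum_le_succ T g n x
    exact absurd (ge_of_tendsto' hlim hnonneg) (not_le.2 hneg)
  · filter_upwards [h] with x hx
    simpa [hU] using hx

/-- Take `b` strictly between the mean and `c`: the sums of `g - b` are bounded by some `K`, and `n
b + K < n c` for large `n`. -/
lemma ae_eventually_birkhoffSum_le [IsProbabilityMeasure μ] (hT : Ergodic T μ)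
    (hgm : Measurable g) (hg : Integrable g μ) {c : ℝ} (hc : ∫ x, g x ∂μ < c) :
    ∀ᵐ x ∂μ, ∀ᶠ n : ℕ in atTop, birkhoffSum T g n x / n < c := by
  obtain ⟨b, hb, hbc⟩ := exists_between hc
  have h := ae_exists_birkhoffSum_le hT (hgm.sub_const b) (hg.sub (integrable_const b))
    (by rw [integral_sub hg (integrable_const b)]; simpa using hb)
  filter_upwards [h] with x ⟨K, hK⟩
  obtain ⟨N, hN⟩ := exists_nat_gt ((K : ℝ) / (c - b))
  filter_upwards [eventually_gt_atTop N] with n hn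
  have hn0 : (0 : ℝ) < n := by exact_mod_cast (Nat.zero_le N).trans_lt hn
  have h1 : birkhoffSum T (fun x => g x - b) n x = birkhoffSum T g n x - n * b := by
    simp [birkhoffSum, Finset.sum_sub_distrib]
  have h2 := hK n
  rw [h1] at h2
  rw [div_lt_iff₀ hn0]
  rw [div_lt_iff₀ (by linarith)] at hN
  have : (N : ℝ) < n := by exact_mod_cast hn
  nlinarith

/-- **Birkhoff's pointwise ergodic theorem** for an ergodic map. -/
theorem ae_tendsto_birkhoffSum_div [IsProbabilityMeasure μ] (hT : Ergodic T μ)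
    (hgm : Measurable g) (hg : Integrable g μ) :
    ∀ᵐ x ∂μ, Tendsto (fun n : ℕ => birkhoffSum T g n x / n) atTop (𝓝 (∫ x, g x ∂μ)) := by
  have h1 : ∀ᵐ x ∂μ, ∀ k : ℕ, ∀ᶠ n : ℕ in atTop,
      birkhoffSum T g n x / n < ∫ x, g x ∂μ + 1 / ((k : ℝ) + 1) :=
    ae_all_iff.2 fun k => ae_eventually_birkhoffSum_le hT hgm hg
      (lt_add_of_pos_right _ Nat.one_div_pos_of_nat)
  have h2 : ∀ᵐ x ∂μ, ∀ k : ℕ, ∀ᶠ n : ℕ in atTop,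
      birkhoffSum T (fun x => -g x) n x / n < ∫ x, -g x ∂μ + 1 / ((k : ℝ) + 1) :=
    ae_all_iff.2 fun k => ae_eventually_birkhoffSum_le hT hgm.neg hg.neg
      (lt_add_of_pos_right _ Nat.one_div_pos_of_nat)
  filter_upwards [h1, h2] with x hx1 hx2
  rw [Metric.tendsto_nhds]
  intro ε hε
  obtain ⟨k, hk⟩ := exists_nat_one_div_lt hε
  filter_upwards [hx1 k, hx2 k] with n h3 h4
  have h5 : birkhoffSum T (fun x => -g x) n x = -birkhoffSum T g n x := by
    simp [birkhoffSum]
  rw [h5, integral_neg, neg_div] at h4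
  rw [Real.dist_eq, abs_lt]
  constructor <;> linarith

open Classical in
/-- The frequency of visits to a set under an ergodic map. -/
lemma ae_tendsto_card_div [IsProbabilityMeasure μ] (hT : Ergodic T μ) {A : Set α}
    (hA : MeasurableSet A) :
    ∀ᵐ x ∂μ, Tendsto
      (fun n : ℕ => (((Finset.range n).filter fun i => T^[i] x ∈ A).card : ℝ) / n) atTop
      (𝓝 (μ.real A)) := by
  have h := ae_tendsto_birkhoffSum_div (g := A.indicator 1) hT (measurable_one.indicator hA)
    ((integrable_const (1 : ℝ)).indicator hA)
  rw [integral_indicator_one hA] at h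
  filter_upwards [h] with x hx
  convert hx using 3 with n
  simp [birkhoffSum, Set.indicator_apply]

open Classical in
/-- The frequency of the times `i ≤ n` at which an event `E (n - i) i`, which depends on a window
reaching `n - i` steps into the future and `i` steps into the past, occurs for the shifted point,
if the event does not depend on the window once the window is large. -/
theorem ae_tendsto_card_window_div [IsProbabilityMeasure μ] (hT : Ergodic T μ)
    {E : ℕ → ℕ → Set α} {A : Set α} (hE : ∀ u v, MeasurableSet (E u v)) (hA : MeasurableSet A)
    (hEA : ∀ x, ∃ K, ∀ u v, K ≤ u → K ≤ v → (x ∈ E u v ↔ x ∈ A)) :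
    ∀ᵐ x ∂μ, Tendsto
      (fun n : ℕ => (((Finset.range (n + 1)).filter fun i => T^[i] x ∈ E (n - i) i).card : ℝ) / n)
      atTop (𝓝 (μ.real A)) := by
  -- `D k` collects the points where some window of size at least `k` on both sides disagrees with
  -- the limit; it decreases to `∅`.
  set D : ℕ → Set α := fun k => ⋃ u, ⋃ v, ⋃ (_ : k ≤ u), ⋃ (_ : k ≤ v), symmDiff (E u v) A with hD
  have hDm : ∀ k, MeasurableSet (D k) := fun k =>
    .iUnion fun u => .iUnion fun v => .iUnion fun _ => .iUnion fun _ => (hE u v).symmDiff hA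
  have hDmem : ∀ k x, x ∈ D k ↔ ∃ u v, k ≤ u ∧ k ≤ v ∧ ¬ (x ∈ E u v ↔ x ∈ A) := by
    intro k x
    simp only [hD, Set.mem_iUnion, exists_prop, Set.mem_symmDiff]
    refine exists_congr fun u => exists_congr fun v => ?_
    tauto
  have hD0 : Tendsto (fun k => μ.real (D k)) atTop (𝓝 0) := by
    have hanti : Antitone D := by
      intro k l hkl x hx
      rw [hDmem] at hx ⊢
      obtain ⟨u, v, hu, hv, h⟩ := hx
      exact ⟨u, v, hkl.trans hu, hkl.trans hv, h⟩
    have hempty : ⋂ k, D k = ∅ := by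
      rw [Set.eq_empty_iff_forall_notMem]
      intro x hx
      obtain ⟨K, hK⟩ := hEA x
      obtain ⟨u, v, hu, hv, h⟩ := (hDmem K x).1 (Set.mem_iInter.1 hx K)
      exact h (hK u v hu hv)
    have h := tendsto_measure_iInter_atTop (μ := μ) (fun k => (hDm k).nullMeasurableSet) hanti
      ⟨0, measure_ne_top _ _⟩
    rw [hempty, measure_empty] at h
    exact (ENNReal.tendsto_toReal ENNReal.zero_ne_top).comp h
  have h1 := ae_tendsto_card_div hT hA
  have h2 : ∀ᵐ x ∂μ, ∀ k, Tendsto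
      (fun n : ℕ => (((Finset.range n).filter fun i => T^[i] x ∈ D k).card : ℝ) / n) atTop
      (𝓝 (μ.real (D k))) := ae_all_iff.2 fun k => ae_tendsto_card_div hT (hDm k)
  filter_upwards [h1, h2] with x hx1 hx2
  set a : ℕ → ℕ := fun n => ((Finset.range (n + 1)).filter fun i => T^[i] x ∈ E (n - i) i).card
  set b : ℕ → ℕ := fun n => ((Finset.range n).filter fun i => T^[i] x ∈ A).card
  set c : ℕ → ℕ → ℕ := fun k n => ((Finset.range n).filter fun i => T^[i] x ∈ D k).card
  -- The two counts differ only at times in `D k` or at times too close to an end: fewer than `k`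
  -- steps of past, fewer than `k` of future, or `i = n`, which `b` does not count. Hence `2 * k +
  -- 1`.
  have key : ∀ k n, a n ≤ b n + c k n + (2 * k + 1) ∧ b n ≤ a n + c k n + (2 * k + 1) := by
    intro k n
    have hR : (Finset.range k ∪ Finset.Ioc (n - k) n ∪ {n}).card ≤ 2 * k + 1 := by
      refine (Finset.card_union_le _ _).trans ?_
      have := Finset.card_union_le (Finset.range k) (Finset.Ioc (n - k) n)
      simp only [Finset.card_range, Nat.card_Ioc, Finset.card_singleton] at this ⊢
      omega
    have hDk : ∀ i, k ≤ i → i ≤ n - k → i < n → (T^[i] x ∈ D k ∨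
        (T^[i] x ∈ E (n - i) i ↔ T^[i] x ∈ A)) := by
      intro i h1 h2 h3
      by_cases h : (T^[i] x ∈ E (n - i) i ↔ T^[i] x ∈ A)
      · exact Or.inr h
      · by_cases hkn : k ≤ n - i
        · exact Or.inl ((hDmem _ _).2 ⟨n - i, i, hkn, h1, h⟩)
        · omega
    constructor
    · refine le_trans (Finset.card_le_card (t := ((Finset.range n).filter fun i => T^[i] x ∈ A) ∪
        ((Finset.range n).filter fun i => T^[i] x ∈ D k) ∪
        (Finset.range k ∪ Finset.Ioc (n - k) n ∪ {n})) ?_) ?_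
      · intro i hi
        simp only [Finset.mem_filter, Finset.mem_range, Finset.mem_union, Finset.mem_Ioc,
          Finset.mem_singleton] at hi ⊢
        have := hDk i
        by_cases h1 : k ≤ i <;> by_cases h2 : i ≤ n - k <;> by_cases h3 : i < n <;>
          first | (have := this h1 h2 h3; tauto) | omega
      · exact (Finset.card_union_le _ _).trans (add_le_add (Finset.card_union_le _ _) hR)
    · refine le_trans (Finset.card_le_card (t :=
        ((Finset.range (n + 1)).filter fun i => T^[i] x ∈ E (n - i) i) ∪
        ((Finset.range n).filter fun i => T^[i] x ∈ D k) ∪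
        (Finset.range k ∪ Finset.Ioc (n - k) n ∪ {n})) ?_) ?_
      · intro i hi
        simp only [Finset.mem_filter, Finset.mem_range, Finset.mem_union, Finset.mem_Ioc,
          Finset.mem_singleton] at hi ⊢
        have := hDk i
        have h4 : i < n + 1 := by omega
        by_cases h1 : k ≤ i <;> by_cases h2 : i ≤ n - k <;> by_cases h3 : i < n <;>
          first | (have := this h1 h2 h3; tauto) | omega
      · exact (Finset.card_union_le _ _).trans (add_le_add (Finset.card_union_le _ _) hR)
  change Tendsto (fun n : ℕ => (a n : ℝ) / n) atTop _
  rw [Metric.tendsto_nhds]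
  intro ε hε
  obtain ⟨k, hk⟩ := ((tendsto_order.1 hD0).2 (ε / 4) (by linarith)).exists
  have e1 := Metric.tendsto_nhds.1 hx1 (ε / 4) (by linarith)
  have e2 := (tendsto_order.1 (hx2 k)).2 (ε / 4) hk
  have e3 := (tendsto_order.1 (tendsto_const_div_atTop_nhds_zero_nat ((2 * k + 1 : ℕ) : ℝ))).2
    (ε / 4) (by linarith)
  filter_upwards [e1, e2, e3] with n h1 h2 h3
  obtain ⟨k1, k2⟩ := key k n
  have k1' : (a n : ℝ) / n ≤ b n / n + c k n / n + ((2 * k + 1 : ℕ) : ℝ) / n := by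
    rw [← add_div, ← add_div]
    gcongr
    exact_mod_cast k1
  have k2' : (b n : ℝ) / n ≤ a n / n + c k n / n + ((2 * k + 1 : ℕ) : ℝ) / n := by
    rw [← add_div, ← add_div]
    gcongr
    exact_mod_cast k2
  rw [Real.dist_eq, abs_lt] at h1 ⊢
  constructor <;> linarith

end Birkhoff

/-! ### Product measures and ergodicity of the two-sided shift -/

lemma measurable_sumElim_comp {E : Type*} [MeasurableSpace E] {ι α β : Type*} (f : ι → α ⊕ β) :
    Measurable fun (q : (α → E) × (β → E)) i => Sum.elim q.1 q.2 (f i) := by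
  refine measurable_pi_lambda _ fun i => ?_
  cases f i <;> simp only [Sum.elim_inl, Sum.elim_inr] <;> fun_prop

/-- The shift of two-sided sequences. -/
def intShift {E : Type*} (ω : ℤ → E) : ℤ → E := fun i => ω (i + 1)

lemma intShift_iterate {E : Type*} (n : ℕ) (ω : ℤ → E) : intShift^[n] ω = fun i => ω (i + n) := by
  induction n generalizing ω with
  | zero => simp
  | succ n ih =>
    rw [Function.iterate_succ_apply, ih]
    ext i
    simp only [intShift]
    congr 1
    push_cast
    ring

section ProductMeasure

variable {E : Type*} [MeasurableSpace E] (μ : Measure E) [IsProbabilityMeasure μ]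

/-- A product of copies of `μ` indexed by `α ⊕ β` is glued from the products indexed by `α`
and `β`. -/
lemma infinitePi_sum (α β : Type*) :
    ((Measure.infinitePi fun _ : α => μ).prod (Measure.infinitePi fun _ : β => μ)).map
      (fun q (i : α ⊕ β) => Sum.elim q.1 q.2 i) = Measure.infinitePi fun _ : α ⊕ β => μ := by
  have hm : Measurable fun (q : (α → E) × (β → E)) (i : α ⊕ β) => Sum.elim q.1 q.2 i :=
    measurable_sumElim_comp id
  refine Measure.eq_infinitePi _ fun s t ht => ?_
  rw [Measure.map_apply hm (.pi s.countable_toSet fun i _ => ht i)]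
  have : (fun (q : (α → E) × (β → E)) (i : α ⊕ β) => Sum.elim q.1 q.2 i) ⁻¹' (Set.pi s t) =
      (Set.pi s.toLeft fun i => t (.inl i)) ×ˢ (Set.pi s.toRight fun i => t (.inr i)) := by
    ext q
    simp [Set.mem_pi]
  rw [this, Measure.prod_prod, Measure.infinitePi_pi _ fun i _ => ht _,
    Measure.infinitePi_pi _ fun i _ => ht _, ← Finset.prod_sumElim]
  rw [Finset.toLeft_disjSum_toRight]
  refine Finset.prod_congr rfl fun i _ => ?_
  cases i <;> rfl

/-- Reading distinct coordinates of a product again gives a product. This serves both to split `ℤ`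
into two halves and to splice two step sequences at a fixed time. -/
lemma infinitePi_sum_comp {ι α β : Type*} {f : ι → α ⊕ β} (hf : Function.Injective f) :
    ((Measure.infinitePi fun _ : α => μ).prod (Measure.infinitePi fun _ : β => μ)).map
      (fun q i => Sum.elim q.1 q.2 (f i)) = Measure.infinitePi fun _ : ι => μ := by
  have h := Measure.map_infinitePi_infinitePi_of_inj (P := fun _ : α ⊕ β => μ) hf
  rw [← infinitePi_sum, Measure.map_map (by fun_prop)
    (show Measurable fun (q : (α → E) × (β → E)) (i : α ⊕ β) => Sum.elim q.1 q.2 i from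
      measurable_sumElim_comp id)] at h
  exact h

lemma measurePreserving_intShift : MeasurePreserving intShift
    (Measure.infinitePi fun _ : ℤ => μ) (Measure.infinitePi fun _ : ℤ => μ) :=
  ⟨measurable_pi_lambda _ fun _ => measurable_pi_apply _,
    Measure.map_infinitePi_infinitePi_of_inj (P := fun _ : ℤ => μ) (add_left_injective 1)⟩

/-- A shift longer than the diameter of `I` moves it to a disjoint set of coordinates, so the
cylinder and its shifted preimage are independent. -/
lemma exists_measureReal_cylinder_inter_shift (I : Finset ℤ) {S : Set (I → E)}
    (hS : MeasurableSet S) : ∃ n : ℕ,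
    (Measure.infinitePi fun _ : ℤ => μ).real (cylinder I S ∩ intShift^[n] ⁻¹' (cylinder I S)) =
      (Measure.infinitePi fun _ : ℤ => μ).real (cylinder I S) ^ 2 := by
  set Q := Measure.infinitePi fun _ : ℤ => μ with hQ
  obtain ⟨M, hM⟩ : ∃ M : ℕ, ∀ i ∈ I, i.natAbs ≤ M :=
    ⟨I.sup Int.natAbs, fun i hi => Finset.le_sup (f := Int.natAbs) hi⟩
  refine ⟨2 * M + 1, ?_⟩
  set n := 2 * M + 1
  have hn : (n : ℤ) = 2 * M + 1 := by simp [n]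
  set J := I.map (addRightEmbedding (n : ℤ)) with hJ
  have hdisj : Disjoint I J := by
    rw [Finset.disjoint_left]
    intro i hi hj
    rw [hJ, Finset.mem_map] at hj
    obtain ⟨j, hj, rfl⟩ := hj
    have h1 := hM _ hi
    have h2 := hM _ hj
    simp only [addRightEmbedding_apply] at h1
    omega
  have hind := (iIndepFun_infinitePi (P := fun _ : ℤ => μ) (X := fun _ x => x)
    fun _ => measurable_id).indepFun_finset I J hdisj fun i => measurable_pi_apply i
  have hind2 := hind.comp (φ := id) (ψ := fun (y : J → E) (i : I) => y ⟨i + n, by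
    rw [hJ, Finset.mem_map]; exact ⟨i, i.2, rfl⟩⟩) measurable_id (by fun_prop)
  have h := hind2.measure_inter_preimage_eq_mul S S hS hS
  have e2 : (intShift^[n] ⁻¹' (cylinder I S) : Set (ℤ → E)) =
      ((fun (y : J → E) (i : I) => y ⟨i + n, by
        rw [hJ, Finset.mem_map]; exact ⟨i, i.2, rfl⟩⟩) ∘ fun a (i : J) => a i) ⁻¹' S := by
    ext ω
    rw [Set.mem_preimage, intShift_iterate]
    rfl
  have e3 : Q.real (intShift^[n] ⁻¹' (cylinder I S)) = Q.real (cylinder I S) :=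
    ((measurePreserving_intShift μ).iterate n).measureReal_preimage
      (hS.cylinder I).nullMeasurableSet
  rw [pow_two]
  nth_rw 2 [← e3]
  rw [e2, measureReal_def, measureReal_def, measureReal_def, ← ENNReal.toReal_mul]
  exact congrArg ENNReal.toReal h

/-- The shift of two-sided sequences is ergodic for a product of copies of `μ`. -/
theorem ergodic_intShift : Ergodic intShift (Measure.infinitePi fun _ : ℤ => μ) := by
  set Q := Measure.infinitePi fun _ : ℤ => μ with hQ
  refine ⟨measurePreserving_intShift μ, ⟨fun A hA hinv => ?_⟩⟩
  have hinvn : ∀ n, intShift^[n] ⁻¹' A = A := fun n => by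
    induction n with
    | zero => rfl
    | succ n ih => rw [Function.iterate_succ', Set.preimage_comp, hinv, ih]
  -- Approximate the invariant `A` by a cylinder `C` that is independent of its shift, so that `Q A`
  -- is close to `Q C ^ 2`. Replacing `C` by `A` and its shift by that of `A` costs `2 * ε`;
  -- squaring, which is 2-Lipschitz on `[0, 1]`, costs another `2 * ε`.
  have key : ∀ ε : ℝ, 0 < ε → |Q.real A - Q.real A ^ 2| ≤ 4 * ε := by
    intro ε hε
    have hring : IsSetRing (measurableCylinders fun _ : ℤ => E) :=
      ⟨empty_mem_measurableCylinders _, fun _ _ => union_mem_measurableCylinders,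
        fun _ _ => sdiff_mem_measurableCylinders⟩
    obtain ⟨C, hC, hCA⟩ := exists_measure_symmDiff_lt_of_generateFrom_isSetRing (μ := Q) hring
      ⟨{Set.univ}, Set.countable_singleton _, by
        simpa using univ_mem_measurableCylinders (fun _ : ℤ => E), by simp⟩
      generateFrom_measurableCylinders.symm hA (ENNReal.ofReal_pos.2 hε)
    obtain ⟨I, S, hS, rfl⟩ := (mem_measurableCylinders C).1 hC
    obtain ⟨n, hn⟩ := exists_measureReal_cylinder_inter_shift μ I hS
    set C : Set (ℤ → E) := cylinder I S with hCdef
    have hCm : MeasurableSet C := hS.cylinder I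
    set D := symmDiff C A with hD
    have hDm : MeasurableSet D := hCm.symmDiff hA
    have hDε : Q.real D < ε := by
      rw [measureReal_def]
      exact (ENNReal.toReal_lt_of_lt_ofReal hCA)
    have hDn : Q.real (intShift^[n] ⁻¹' D) = Q.real D :=
      ((measurePreserving_intShift μ).iterate n).measureReal_preimage hDm.nullMeasurableSet
    have hAn : ∀ ω, intShift^[n] ω ∈ A ↔ ω ∈ A := fun ω => by
      rw [← Set.mem_preimage, hinvn]
    have a1 : Q.real A ≤ Q.real (C ∩ intShift^[n] ⁻¹' C) + Q.real D + Q.real D := by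
      refine le_trans (measureReal_mono (s₂ := (C ∩ intShift^[n] ⁻¹' C) ∪ D ∪ intShift^[n] ⁻¹' D) ?_)
        ((measureReal_union_le _ _).trans
          (add_le_add (measureReal_union_le _ _) hDn.le))
      intro ω hω
      have := hAn ω
      simp only [Set.mem_union, Set.mem_inter_iff, Set.mem_preimage, hD, Set.mem_symmDiff]
      tauto
    have a2 : Q.real (C ∩ intShift^[n] ⁻¹' C) ≤ Q.real A + Q.real D := by
      refine le_trans (measureReal_mono (s₂ := A ∪ D) ?_) (measureReal_union_le _ _)
      intro ω hω
      simp only [Set.mem_union, Set.mem_inter_iff, Set.mem_preimage, hD, Set.mem_symmDiff] at hω ⊢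
      tauto
    have a3 : Q.real A ≤ Q.real C + Q.real D := by
      refine le_trans (measureReal_mono (s₂ := C ∪ D) ?_) (measureReal_union_le _ _)
      intro ω hω
      simp only [Set.mem_union, hD, Set.mem_symmDiff]
      tauto
    have a4 : Q.real C ≤ Q.real A + Q.real D := by
      refine le_trans (measureReal_mono (s₂ := A ∪ D) ?_) (measureReal_union_le _ _)
      intro ω hω
      simp only [Set.mem_union, hD, Set.mem_symmDiff]
      tauto
    rw [hn] at a1 a2
    have b1 : Q.real A ≤ 1 := measureReal_le_one
    have b2 : Q.real C ≤ 1 := measureReal_le_one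
    have b3 : 0 ≤ Q.real A := measureReal_nonneg
    have b4 : 0 ≤ Q.real C := measureReal_nonneg
    have b5 : 0 ≤ Q.real D := measureReal_nonneg
    rw [abs_le]
    constructor <;> nlinarith
  have hzero : Q.real A - Q.real A ^ 2 = 0 := by
    rw [← abs_eq_zero]
    refine le_antisymm (le_of_forall_pos_le_add fun ε hε => ?_) (abs_nonneg _)
    have := key (ε / 4) (by positivity)
    linarith
  rw [eventuallyConst_set']
  have h01 : Q.real A = 0 ∨ Q.real A = 1 := by
    have : Q.real A * (1 - Q.real A) = 0 := by linarith [hzero]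
    rcases mul_eq_zero.1 this with h | h
    · exact Or.inl h
    · exact Or.inr (by linarith)
  rcases h01 with h | h
  · exact Or.inl (ae_eq_empty.2 ((measureReal_eq_zero_iff).1 h))
  · right
    rw [ae_eq_univ, prob_compl_eq_zero_iff hA]
    rw [measureReal_def] at h
    exact (ENNReal.toReal_eq_one_iff _).1 h

end ProductMeasure

/-! ### Window events and their pointwise limits -/

section Windows

variable {d : ℕ}

/-- The number of returns of `s` to the origin at the times `1, …, u`. -/
def returns (s : Trajectory d) (u : ℕ) : ℕ := Nat.count (fun j => s (j + 1) = 0) u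

/-- The pairs of a forward and a backward trajectory such that the forward one returns `k` times
to the origin within `u` steps, and such that the first `u` steps of the forward one and the first
`v` steps of the backward one do not cover the neighbours of the origin. -/
def windowAtLeast (k u v : ℕ) : Set (Trajectory d × Trajectory d) :=
  {w | returns w.1 u = k ∧
    ¬ neighbors (0 : IntLattice d) ⊆ w.1 '' Set.Iic u ∪ w.2 '' Set.Iic v}

/-- The pairs in `windowAtLeast k u v` whose backward trajectory does not return to the origin
within `v` steps. -/
def windowExactly (k u v : ℕ) : Set (Trajectory d × Trajectory d) :=
  {w | w ∈ windowAtLeast k u v ∧ returns w.2 v = 0}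

/-- The trajectories that return exactly `k` times to the origin. -/
def returnsTotal (d k : ℕ) : Set (Trajectory d) := {s | ∃ K, ∀ u, K ≤ u → returns s u = k}

/-- The limit of `windowAtLeast k u v` for `u, v → ∞`. -/
def limitAtLeast (d k : ℕ) : Set (Trajectory d × Trajectory d) :=
  {w | w.1 ∈ returnsTotal d k ∧ ¬ neighbors (0 : IntLattice d) ⊆ Set.range w.1 ∪ Set.range w.2}

/-- The limit of `windowExactly k u v` for `u, v → ∞`. -/
def limitExactly (d k : ℕ) : Set (Trajectory d × Trajectory d) :=
  {w | w ∈ limitAtLeast d k ∧ 0 ∉ futureRange w.2}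

lemma mem_neighbors_iff_sub (z a : IntLattice d) :
    z ∈ neighbors a ↔ z - a ∈ neighbors (0 : IntLattice d) := by
  simp [neighbors]

lemma zero_notMem_neighbors : (0 : IntLattice d) ∉ neighbors (0 : IntLattice d) := by
  simp [neighbors]

lemma finite_neighbors (a : IntLattice d) : (neighbors a).Finite := by
  refine (Set.finite_Icc (a - 1) (a + 1)).subset fun z hz => ?_
  have h : ∀ j, |z j - a j| ≤ 1 := fun j => by
    rw [← show ∑ j, |z j - a j| = 1 from hz]
    exact Finset.single_le_sum (f := fun j => |z j - a j|) (fun _ _ => abs_nonneg _)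
      (Finset.mem_univ j)
  refine ⟨fun j => ?_, fun j => ?_⟩
  · have := (abs_le.1 (h j)).1
    simp only [Pi.sub_apply, Pi.one_apply]
    linarith
  · have := (abs_le.1 (h j)).2
    simp only [Pi.add_apply, Pi.one_apply]
    linarith

lemma returns_mono (s : Trajectory d) : Monotone (returns s) := Nat.count_monotone _

/-- Either the count settles at `k`, or it reaches `k + 1` and stays above `k`, or it never equals
`k` at all. -/
lemma exists_returns_eq_iff (s : Trajectory d) (k : ℕ) :
    ∃ K, ∀ u, K ≤ u → (returns s u = k ↔ s ∈ returnsTotal d k) := by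
  by_cases h : s ∈ returnsTotal d k
  · obtain ⟨K, hK⟩ := h
    exact ⟨K, fun u hu => ⟨fun _ => ⟨K, hK⟩, fun _ => hK u hu⟩⟩
  · by_cases h' : ∃ K, returns s K = k + 1
    · obtain ⟨K, hK⟩ := h'
      refine ⟨K, fun u hu => ⟨fun h1 => ?_, fun h1 => absurd h1 h⟩⟩
      have := returns_mono s hu
      omega
    -- The count grows by unit steps, so if it never equals `k + 1` it cannot leave the value `k`.
    · refine ⟨0, fun u _ => ⟨fun h1 => ?_, fun h1 => absurd h1 h⟩⟩
      refine ⟨u, fun v hv => ?_⟩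
      induction v, hv using Nat.le_induction with
      | base => exact h1
      | succ v hv ih =>
        have h2 : returns s (v + 1) = returns s v + if s (v + 1) = 0 then 1 else 0 :=
          Nat.count_succ _ _
        split_ifs at h2
        · exact absurd ⟨v + 1, by rw [h2, ih]⟩ h'
        · rw [h2, ih, add_zero]

lemma returns_eq_zero_iff (s : Trajectory d) (u : ℕ) :
    returns s u = 0 ↔ ∀ j < u, s (j + 1) ≠ 0 := by
  rw [returns, Nat.count_eq_card_filter_range, Finset.card_eq_zero, Finset.filter_eq_empty_iff]
  simp

lemma zero_mem_futureRange_iff (s : Trajectory d) :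
    (0 : IntLattice d) ∈ futureRange s ↔ ∃ j, s (j + 1) = 0 := by
  constructor
  · rintro ⟨m, hm, h⟩
    rw [Set.mem_Ici] at hm
    exact ⟨m - 1, by rw [Nat.sub_add_cancel hm, h]⟩
  · rintro ⟨j, h⟩
    exact ⟨j + 1, by simp, h⟩

lemma exists_returns_eq_zero_iff (s : Trajectory d) :
    ∃ K, ∀ u, K ≤ u → (returns s u = 0 ↔ 0 ∉ futureRange s) := by
  simp_rw [returns_eq_zero_iff, zero_mem_futureRange_iff]
  by_cases h : ∃ j, s (j + 1) = 0
  · obtain ⟨j, hj⟩ := h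
    exact ⟨j + 1, fun u hu => ⟨fun h1 => absurd hj (h1 j hu), fun h1 => absurd ⟨j, hj⟩ h1⟩⟩
  · exact ⟨0, fun u _ => ⟨fun _ => h, fun _ j _ hj => h ⟨j, hj⟩⟩⟩

lemma mem_returnsTotal_zero_iff (s : Trajectory d) :
    s ∈ returnsTotal d 0 ↔ 0 ∉ futureRange s := by
  obtain ⟨K, hK⟩ := exists_returns_eq_zero_iff s
  obtain ⟨L, hL⟩ := exists_returns_eq_iff s 0
  rw [← hK (max K L) (le_max_left _ _), hL (max K L) (le_max_right _ _)]

/-- Each of the finitely many neighbours that is ever reached is reached by a finite time; take a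
common bound. -/
lemma exists_covered_iff (s s' : Trajectory d) : ∃ K, ∀ u v, K ≤ u → K ≤ v →
    (neighbors (0 : IntLattice d) ⊆ s '' Set.Iic u ∪ s' '' Set.Iic v ↔
      neighbors (0 : IntLattice d) ⊆ Set.range s ∪ Set.range s') := by
  by_cases h : neighbors (0 : IntLattice d) ⊆ Set.range s ∪ Set.range s'
  · have h1 : ∀ x ∈ neighbors (0 : IntLattice d), ∀ᶠ K : ℕ in atTop,
        x ∈ s '' Set.Iic K ∪ s' '' Set.Iic K := by
      intro x hx
      rcases h hx with ⟨m, rfl⟩ | ⟨m, rfl⟩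
      · filter_upwards [eventually_ge_atTop m] with K hK using Or.inl ⟨m, hK, rfl⟩
      · filter_upwards [eventually_ge_atTop m] with K hK using Or.inr ⟨m, hK, rfl⟩
    obtain ⟨K, hK⟩ := ((finite_neighbors 0).eventually_all.2 h1).exists
    refine ⟨K, fun u v hu hv => ⟨fun _ => h, fun _ x hx => ?_⟩⟩
    exact Set.union_subset_union (Set.image_mono (Set.Iic_subset_Iic.2 hu))
      (Set.image_mono (Set.Iic_subset_Iic.2 hv)) (hK x hx)
  · refine ⟨0, fun u v _ _ => ⟨fun h1 => absurd (h1.trans ?_) h, fun h1 => absurd h1 h⟩⟩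
    exact Set.union_subset_union (Set.image_subset_range _ _) (Set.image_subset_range _ _)

lemma exists_mem_windowAtLeast_iff (k : ℕ) (w : Trajectory d × Trajectory d) :
    ∃ K, ∀ u v, K ≤ u → K ≤ v → (w ∈ windowAtLeast k u v ↔ w ∈ limitAtLeast d k) := by
  obtain ⟨K, hK⟩ := exists_returns_eq_iff w.1 k
  obtain ⟨L, hL⟩ := exists_covered_iff w.1 w.2
  refine ⟨max K L, fun u v hu hv => ?_⟩
  exact and_congr (hK u (le_of_max_le_left hu))
    (not_congr (hL u v (le_of_max_le_right hu) (le_of_max_le_right hv)))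

lemma exists_mem_windowExactly_iff (k : ℕ) (w : Trajectory d × Trajectory d) :
    ∃ K, ∀ u v, K ≤ u → K ≤ v → (w ∈ windowExactly k u v ↔ w ∈ limitExactly d k) := by
  obtain ⟨K, hK⟩ := exists_mem_windowAtLeast_iff k w
  obtain ⟨L, hL⟩ := exists_returns_eq_zero_iff w.2
  refine ⟨max K L, fun u v hu hv => ?_⟩
  exact and_congr (hK u v (le_of_max_le_left hu) (le_of_max_le_left hv))
    (hL v (le_of_max_le_right hv))

end Windows

/-! ### Counting boundary points by their `p`-th last visit -/

section Counting

variable {d : ℕ}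

lemma visits_eq_count (s : Trajectory d) (n : ℕ) (x : IntLattice d) :
    visits s n x = Nat.count (fun m => s m = x) (n + 1) := by
  rw [Nat.count_eq_card_filter_range, visits, ← Set.ncard_coe_finset]
  congr 1
  ext m
  simp

/-- The times `i ≤ n` at which an inner boundary point is visited that is visited exactly `p`
times in `i, …, n`. -/
def lastVisitTimes (s : Trajectory d) (p n : ℕ) : Set ℕ :=
  {i | i ≤ n ∧ s i ∈ innerBoundary s n ∧
    Nat.count (fun m => s m = s i) (n + 1) = Nat.count (fun m => s m = s i) i + p}

/-- Two such visits to one point are preceded by equally many visits to it, hence coincide. -/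
lemma injOn_lastVisitTimes (s : Trajectory d) (p n : ℕ) :
    Set.InjOn s (lastVisitTimes s p n) := by
  intro i hi j hj hij
  have h1 := hi.2.2
  have h2 := hj.2.2
  rw [hij] at h1
  exact Nat.count_injective (p := fun m => s m = s j) hij rfl (by omega)

lemma image_lastVisitTimes (s : Trajectory d) {p : ℕ} (hp : 1 ≤ p) (n : ℕ) :
    s '' lastVisitTimes s p n = {x | x ∈ innerBoundary s n ∧ p ≤ visits s n x} := by
  ext x
  constructor
  · rintro ⟨i, ⟨hin, hi, hc⟩, rfl⟩
    refine ⟨hi, ?_⟩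
    rw [visits_eq_count]
    omega
  · rintro ⟨hx, hv⟩
    rw [visits_eq_count] at hv
    have hlt : Nat.count (fun m => s m = x) (n + 1) - p < Nat.count (fun m => s m = x) (n + 1) := by
      omega
    -- Visits are numbered from `0`, so this index is the `p`-th from the end.
    set i := Nat.nth (fun m => s m = x) (Nat.count (fun m => s m = x) (n + 1) - p) with hi
    have hin : i < n + 1 := Nat.nth_lt_of_lt_count hlt
    -- `Nat.nth` takes a default value past the last element of a finite set; this bound excludes
    -- that case.
    have hlt' : ∀ hf : {m | s m = x}.Finite,
        Nat.count (fun m => s m = x) (n + 1) - p < hf.toFinset.card := fun hf =>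
      hlt.trans_le (Nat.count_le_card hf _)
    have hsi : s i = x := Nat.nth_mem _ hlt'
    refine ⟨i, ⟨Nat.lt_succ_iff.1 hin, by rwa [hsi], ?_⟩, hsi⟩
    rw [hsi]
    have : Nat.count (fun m => s m = x) i = Nat.count (fun m => s m = x) (n + 1) - p :=
      Nat.count_nth hlt'
    omega

lemma countAtLeast_eq_ncard (s : Trajectory d) {p : ℕ} (hp : 1 ≤ p) (n : ℕ) :
    countAtLeast s p n = (lastVisitTimes s p n).ncard := by
  rw [countAtLeast, ← image_lastVisitTimes s hp, (injOn_lastVisitTimes s p n).ncard_image]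

lemma countExactly_eq_ncard (s : Trajectory d) {p : ℕ} (hp : 1 ≤ p) (n : ℕ) :
    countExactly s p n =
      {i | i ∈ lastVisitTimes s p n ∧ Nat.count (fun m => s m = s i) i = 0}.ncard := by
  have h : s '' {i | i ∈ lastVisitTimes s p n ∧ Nat.count (fun m => s m = s i) i = 0} =
      {x | x ∈ innerBoundary s n ∧ visits s n x = p} := by
    ext x
    constructor
    · rintro ⟨i, ⟨⟨hin, hi, hc⟩, h0⟩, rfl⟩
      refine ⟨hi, ?_⟩
      rw [visits_eq_count]
      omega
    · rintro ⟨hx, hv⟩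
      have : x ∈ s '' lastVisitTimes s p n := by
        rw [image_lastVisitTimes s hp]
        exact ⟨hx, hv.ge⟩
      obtain ⟨i, hi, rfl⟩ := this
      refine ⟨i, ⟨hi, ?_⟩, rfl⟩
      have := hi.2.2
      rw [visits_eq_count] at hv
      omega
  rw [countExactly, ← h,
    ((injOn_lastVisitTimes s p n).mono fun i hi => hi.1).ncard_image]

/-- Membership in `lastVisitTimes` in terms of the trajectory seen from its position at time `i`. -/
lemma mem_lastVisitTimes_iff {s f b : Trajectory d} {i n : ℕ} (k : ℕ) (hin : i ≤ n)
    (hf : ∀ m, f m = s (i + m) - s i) (hb : ∀ m ≤ i, b m = s (i - m) - s i) :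
    i ∈ lastVisitTimes s (k + 1) n ↔ (f, b) ∈ windowAtLeast k (n - i) i := by
  have hcount : Nat.count (fun m => s m = s i) (n + 1) =
      Nat.count (fun m => s m = s i) i + (returns f (n - i) + 1) := by
    -- Past, present and future: the visit at time `i` itself accounts for the difference between `k
    -- + 1` visits and `k` returns.
    rw [show n + 1 = i + (1 + (n - i)) by omega, Nat.count_add, Nat.count_add]
    have : returns f (n - i) = Nat.count (fun k => s (i + (1 + k)) = s i) (n - i) := by
      simp only [returns, hf, sub_eq_zero, add_comm 1]
    rw [this]
    simp [Nat.count_succ, add_comm]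
  have hcov : f '' Set.Iic (n - i) ∪ b '' Set.Iic i = (fun x => x - s i) '' (s '' Set.Iic n) := by
    ext z
    constructor
    · rintro (⟨m, hm, rfl⟩ | ⟨m, hm, rfl⟩)
      · rw [Set.mem_Iic] at hm
        exact ⟨s (i + m), ⟨i + m, by rw [Set.mem_Iic]; omega, rfl⟩, (hf m).symm⟩
      · rw [Set.mem_Iic] at hm
        exact ⟨s (i - m), ⟨i - m, by rw [Set.mem_Iic]; omega, rfl⟩, (hb m hm).symm⟩
    · rintro ⟨_, ⟨m, hm, rfl⟩, rfl⟩
      rw [Set.mem_Iic] at hm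
      rcases le_total i m with h | h
      · refine Or.inl ⟨m - i, by rw [Set.mem_Iic]; omega, ?_⟩
        rw [hf, Nat.add_sub_cancel' h]
      · refine Or.inr ⟨i - m, by rw [Set.mem_Iic]; omega, ?_⟩
        rw [hb _ (by omega), Nat.sub_sub_self h]
  have hnb : neighbors (0 : IntLattice d) ⊆ (fun x => x - s i) '' (s '' Set.Iic n) ↔
      neighbors (s i) ⊆ s '' Set.Iic n := by
    constructor
    · intro h z hz
      obtain ⟨x, hx, hxz⟩ := h ((mem_neighbors_iff_sub z (s i)).1 hz)
      rwa [← sub_left_inj.1 hxz]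
    · intro h z hz
      refine ⟨z + s i, h ?_, add_sub_cancel_right _ _⟩
      rwa [mem_neighbors_iff_sub, add_sub_cancel_right]
  simp only [lastVisitTimes, windowAtLeast, innerBoundary, Set.mem_ofPred_eq]
  rw [hcov, hnb, hcount]
  constructor
  · rintro ⟨-, ⟨-, h1⟩, h2⟩
    exact ⟨by omega, h1⟩
  · rintro ⟨h2, h1⟩
    exact ⟨hin, ⟨⟨i, hin, rfl⟩, h1⟩, by omega⟩

lemma count_eq_zero_iff_returns {s b : Trajectory d} {i : ℕ}
    (hb : ∀ m ≤ i, b m = s (i - m) - s i) :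
    Nat.count (fun m => s m = s i) i = 0 ↔ returns b i = 0 := by
  rw [returns_eq_zero_iff, Nat.count_eq_card_filter_range, Finset.card_eq_zero,
    Finset.filter_eq_empty_iff]
  simp only [Finset.mem_range]
  constructor
  · intro h j hj h0
    rw [hb _ hj, sub_eq_zero] at h0
    exact h (by omega) h0
  · intro h m hm h0
    refine h (i - 1 - m) (by omega) ?_
    rw [hb _ (by omega), show i - (i - 1 - m + 1) = m by omega, h0, sub_self]

/-- The walk from the origin with the given steps. -/
def stepWalk (ξ : ℕ → IntLattice d) : Trajectory d := fun m => ∑ j ∈ Finset.range m, ξ j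

/-- The forward and the backward trajectory of a two-sided sequence of steps. -/
def twoSidedWalk (ω : ℤ → IntLattice d) : Trajectory d × Trajectory d :=
  (stepWalk fun j => ω j, -stepWalk fun j => ω (Int.negSucc j))

lemma forward_intShift (a : IntLattice d) (ω : ℤ → IntLattice d) (i m : ℕ) :
    (twoSidedWalk (intShift^[i] ω)).1 m =
      (a + stepWalk (fun j => ω j) (i + m)) - (a + stepWalk (fun j => ω j) i) := by
  simp only [twoSidedWalk, stepWalk, intShift_iterate, Finset.sum_range_add, add_sub_add_left_eq_sub,
    add_sub_cancel_left]
  refine Finset.sum_congr rfl fun j _ => ?_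
  congr 1
  push_cast
  ring

/-- The backward walk undoes the steps `i - 1, …, i - m`. Beyond `m = i` it would use negative
coordinates of `ω`, which the one-sided walk does not see. -/
lemma backward_intShift (a : IntLattice d) (ω : ℤ → IntLattice d) (i m : ℕ) (hm : m ≤ i) :
    (twoSidedWalk (intShift^[i] ω)).2 m =
      (a + stepWalk (fun j => ω j) (i - m)) - (a + stepWalk (fun j => ω j) i) := by
  obtain ⟨l, rfl⟩ := Nat.exists_eq_add_of_le' hm
  simp only [twoSidedWalk, stepWalk, intShift_iterate, Finset.sum_range_add, Pi.neg_apply,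
    add_sub_add_left_eq_sub, Nat.add_sub_cancel, sub_add_cancel_left, neg_inj]
  rw [← Finset.sum_range_reflect]
  refine Finset.sum_congr rfl fun j hj => ?_
  rw [Finset.mem_range] at hj
  congr 1
  rw [Int.negSucc_eq]
  omega

open Classical in
lemma countAtLeast_eq_card (a : IntLattice d) (ω : ℤ → IntLattice d) (k n : ℕ) :
    countAtLeast (fun m => a + stepWalk (fun j => ω j) m) (k + 1) n =
      ((Finset.range (n + 1)).filter fun i =>
        intShift^[i] ω ∈ twoSidedWalk ⁻¹' windowAtLeast k (n - i) i).card := by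
  rw [countAtLeast_eq_ncard _ (Nat.le_add_left 1 k), ← Set.ncard_coe_finset]
  congr 1
  ext i
  by_cases hin : i ≤ n
  · rw [mem_lastVisitTimes_iff k hin (forward_intShift a ω i) (backward_intShift a ω i)]
    simp [hin]
  · simp [hin, lastVisitTimes]

open Classical in
lemma countExactly_eq_card (a : IntLattice d) (ω : ℤ → IntLattice d) (k n : ℕ) :
    countExactly (fun m => a + stepWalk (fun j => ω j) m) (k + 1) n =
      ((Finset.range (n + 1)).filter fun i =>
        intShift^[i] ω ∈ twoSidedWalk ⁻¹' windowExactly k (n - i) i).card := by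
  rw [countExactly_eq_ncard _ (Nat.le_add_left 1 k), ← Set.ncard_coe_finset]
  congr 1
  ext i
  rw [Set.mem_ofPred_eq]
  by_cases hin : i ≤ n
  · rw [mem_lastVisitTimes_iff k hin (forward_intShift a ω i) (backward_intShift a ω i),
      count_eq_zero_iff_returns (s := fun m => a + stepWalk (fun j => ω j) m)
        (backward_intShift a ω i)]
    rw [Finset.mem_coe, Finset.mem_filter, Finset.mem_range]
    simp [hin, windowExactly]
  · simp [hin, lastVisitTimes]

end Counting

/-! ### Measurability of the events -/

section Measurability

variable {d : ℕ} {α : Type*} [MeasurableSpace α]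

lemma measurable_trajectory_apply_eq (m : ℕ) (z : IntLattice d) :
    Measurable fun s : Trajectory d => s m = z :=
  measurableSet_setOfPred.1 (measurableSet_eq_fun (measurable_pi_apply m) measurable_const)

lemma measurable_mem_range (z : IntLattice d) :
    Measurable fun s : Trajectory d => z ∈ Set.range s :=
  Measurable.exists fun m => measurable_trajectory_apply_eq m z

lemma measurable_mem_image (z : IntLattice d) (I : Set ℕ) :
    Measurable fun s : Trajectory d => z ∈ s '' I :=
  Measurable.exists fun m => measurable_const.and (measurable_trajectory_apply_eq m z)

lemma le_passageTime_iff (s : Trajectory d) (a : IntLattice d) (m : ℕ) :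
    (m : ℕ∞) ≤ passageTime s a ↔ ∀ j : ℕ, 1 ≤ j → s j = a → m ≤ j := by
  rw [passageTime, le_sInf_iff]
  simp only [Set.forall_mem_image, Set.mem_ofPred_eq, and_imp, Nat.cast_le]

lemma measurable_mem_excursionRange (z : IntLattice d) :
    Measurable fun s : Trajectory d => z ∈ excursionRange s := by
  simp only [excursionRange, Set.mem_image, Set.mem_ofPred_eq, le_passageTime_iff]
  exact Measurable.exists fun m => (Measurable.forall fun j => measurable_const.imp
    ((measurable_trajectory_apply_eq j 0).imp measurable_const)).and
      (measurable_trajectory_apply_eq m z)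

lemma measurable_mem_futureRange (z : IntLattice d) :
    Measurable fun s : Trajectory d => z ∈ futureRange s := measurable_mem_image z _

lemma measurable_returns (u : ℕ) : Measurable fun s : Trajectory d => returns s u := by
  induction u with
  | zero => simp [returns]
  | succ u ih =>
    simp only [returns, Nat.count_succ] at ih ⊢
    exact ih.add (Measurable.ite (measurable_pi_apply (u + 1) (measurableSet_singleton 0))
      measurable_const measurable_const)

lemma measurable_returns_eq (u k : ℕ) :
    Measurable fun s : Trajectory d => returns s u = k :=
  measurableSet_setOfPred.1 (measurable_returns u (measurableSet_singleton k))

lemma measurable_mem_returnsTotal (k : ℕ) :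
    Measurable fun s : Trajectory d => s ∈ returnsTotal d k :=
  Measurable.exists fun _ => Measurable.forall fun u =>
    measurable_const.imp (measurable_returns_eq u k)

/-- Being covered by a random set is an event. -/
lemma measurable_subset {A : Set (IntLattice d)} {f : α → Set (IntLattice d)}
    (hf : ∀ z, Measurable fun x => z ∈ f x) : Measurable fun x => A ⊆ f x :=
  Measurable.forall fun z => measurable_const.imp (hf z)

lemma measurableSet_windowAtLeast (k u v : ℕ) :
    MeasurableSet (windowAtLeast (d := d) k u v) := by
  refine measurableSet_setOfPred.2 (((measurable_returns_eq u k).comp measurable_fst).and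
    (measurable_subset fun z => ?_).not)
  exact ((measurable_mem_image z _).comp measurable_fst).or
    ((measurable_mem_image z _).comp measurable_snd)

lemma measurableSet_windowExactly (k u v : ℕ) :
    MeasurableSet (windowExactly (d := d) k u v) :=
  (measurableSet_windowAtLeast k u v).inter
    (measurableSet_setOfPred.2 ((measurable_returns_eq v 0).comp measurable_snd))

lemma measurableSet_limitAtLeast (k : ℕ) : MeasurableSet (limitAtLeast d k) := by
  refine measurableSet_setOfPred.2 (((measurable_mem_returnsTotal k).comp measurable_fst).and
    (measurable_subset fun z => ?_).not)
  exact ((measurable_mem_range z).comp measurable_fst).or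
    ((measurable_mem_range z).comp measurable_snd)

lemma measurableSet_limitExactly (k : ℕ) : MeasurableSet (limitExactly d k) :=
  (measurableSet_limitAtLeast k).inter
    (measurableSet_setOfPred.2 ((measurable_mem_futureRange 0).not.comp measurable_snd))

lemma measurable_stepWalk : Measurable (stepWalk (d := d)) :=
  measurable_pi_lambda _ fun _ => Finset.measurable_sum _ fun j _ => measurable_pi_apply j

lemma measurable_twoSidedWalk : Measurable (twoSidedWalk (d := d)) := by
  refine Measurable.prodMk (measurable_stepWalk.comp ?_) (measurable_stepWalk.comp ?_).neg <;>
    exact measurable_pi_lambda _ fun _ => measurable_pi_apply _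

end Measurability

/-! ### Cutting a trajectory at its first return -/

section Excursions

variable {d : ℕ}

/-- The trajectories with first return to the origin at time `m + 1`. -/
def firstReturn (d m : ℕ) : Set (Trajectory d) :=
  {s | s (m + 1) = 0 ∧ ∀ j < m, s (j + 1) ≠ 0}

/-- The trajectory that follows `w.1` up to time `m` and then the increments of `w.2`. -/
def concatAt (m : ℕ) (w : Trajectory d × Trajectory d) : Trajectory d :=
  fun j => if j ≤ m then w.1 j else w.1 m + w.2 (j - m)

lemma iUnion_firstReturn : ⋃ m, firstReturn d m = {s | 0 ∈ futureRange s} := by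
  ext s
  rw [Set.mem_iUnion, Set.mem_ofPred_eq, zero_mem_futureRange_iff]
  constructor
  · rintro ⟨m, hm⟩
    exact ⟨m, hm.1⟩
  · intro h
    exact ⟨Nat.find h, Nat.find_spec h, fun j hj => Nat.find_min h hj⟩

lemma pairwise_disjoint_firstReturn : Pairwise (Function.onFun Disjoint (firstReturn d)) := by
  intro m n hmn
  rw [Function.onFun, Set.disjoint_left]
  intro s hm hn
  rcases lt_or_gt_of_ne hmn with h | h
  · exact hn.2 m h hm.1
  · exact hm.2 n h hn.1

lemma measurableSet_firstReturn (m : ℕ) : MeasurableSet (firstReturn d m) :=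
  measurableSet_setOfPred.2 ((measurable_trajectory_apply_eq _ _).and
    (Measurable.forall fun _ => measurable_const.imp (measurable_trajectory_apply_eq _ _).not))

lemma measurable_concatAt (m : ℕ) : Measurable (concatAt (d := d) m) := by
  refine measurable_pi_lambda _ fun j => ?_
  simp only [concatAt]
  split_ifs <;> fun_prop

lemma concatAt_mem_firstReturn_iff (m : ℕ) (w : Trajectory d × Trajectory d) :
    concatAt (m + 1) w ∈ firstReturn d m ↔ w.1 ∈ firstReturn d m := by
  simp only [firstReturn, concatAt, Set.mem_ofPred_eq, le_refl, if_true]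
  refine and_congr Iff.rfl (forall₂_congr fun j _ => ?_)
  rw [if_pos (by omega)]

lemma concatAt_add {m : ℕ} {w : Trajectory d × Trajectory d} (h : w.1 ∈ firstReturn d m) (j : ℕ) :
    concatAt (m + 1) w (m + 1 + (j + 1)) = w.2 (j + 1) := by
  rw [concatAt, if_neg (by omega), h.1, zero_add, Nat.add_sub_cancel_left]

/-- The first piece contributes only its return at time `m + 1`; being then at the origin, the
trajectory continues as `w.2` itself. -/
lemma returns_concatAt {m : ℕ} {w : Trajectory d × Trajectory d} (h : w.1 ∈ firstReturn d m)
    (u : ℕ) : returns (concatAt (m + 1) w) (m + 1 + u) = returns w.2 u + 1 := by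
  have h' := (concatAt_mem_firstReturn_iff m w).2 h
  have h0 : returns (concatAt (m + 1) w) m = 0 := (returns_eq_zero_iff _ _).2 h'.2
  have h1 : returns (concatAt (m + 1) w) (m + 1) = 1 := by
    rw [returns] at h0 ⊢
    rw [Nat.count_succ, h0, if_pos h'.1]
  have h2 : returns w.2 u =
      Nat.count (fun j => concatAt (m + 1) w (m + 1 + j + 1) = 0) u := by
    simp only [returns, add_assoc (m + 1), concatAt_add h]
  rw [h2, returns, Nat.count_add, ← returns, h1, add_comm]

lemma concatAt_mem_returnsTotal_iff {m : ℕ} {w : Trajectory d × Trajectory d}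
    (h : w.1 ∈ firstReturn d m) (k : ℕ) :
    concatAt (m + 1) w ∈ returnsTotal d (k + 1) ↔ w.2 ∈ returnsTotal d k := by
  constructor
  · rintro ⟨K, hK⟩
    refine ⟨K, fun u hu => ?_⟩
    have := hK (m + 1 + u) (by omega)
    rw [returns_concatAt h] at this
    omega
  · rintro ⟨K, hK⟩
    refine ⟨m + 1 + K, fun u hu => ?_⟩
    obtain ⟨v, rfl⟩ := Nat.exists_eq_add_of_le ((Nat.le_add_right (m + 1) K).trans hu)
    rw [returns_concatAt h, hK v (by omega)]

lemma excursionRange_eq {m : ℕ} {s : Trajectory d} (h : s ∈ firstReturn d m) :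
    excursionRange s = s '' Set.Iic (m + 1) := by
  rw [excursionRange]
  congr 1
  ext l
  rw [Set.mem_ofPred_eq, le_passageTime_iff, Set.mem_Iic]
  constructor
  · intro hl
    exact hl (m + 1) (by omega) h.1
  · intro hl j hj hj0
    by_contra hlt
    refine h.2 (j - 1) (by omega) ?_
    rw [Nat.sub_add_cancel hj, hj0]

/-- The ranges can differ only by the starting point of `w.2`, which is the origin and so not one of
its own neighbours. -/
lemma neighbors_subset_concatAt_iff {m : ℕ} {w : Trajectory d × Trajectory d}
    (h : w.1 ∈ firstReturn d m) (h0 : w.2 0 = 0) (G : Set (IntLattice d)) :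
    neighbors (0 : IntLattice d) ⊆ Set.range (concatAt (m + 1) w) ∪ G ↔
      neighbors (0 : IntLattice d) ⊆ Set.range w.2 ∪ (excursionRange w.1 ∪ G) := by
  rw [excursionRange_eq h, ← Set.union_assoc]
  refine forall₂_congr fun z hz => or_congr_left ?_
  constructor
  · rintro ⟨j, rfl⟩
    rcases le_or_gt j (m + 1) with hj | hj
    · exact Or.inr ⟨j, hj, by simp [concatAt, hj]⟩
    · obtain ⟨l, rfl⟩ := Nat.exists_eq_add_of_lt hj
      exact Or.inl ⟨l + 1, (concatAt_add h l).symm⟩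
  · rintro (⟨j, rfl⟩ | ⟨j, hj, rfl⟩)
    · cases j with
      | zero => exact absurd (h0 ▸ hz) zero_notMem_neighbors
      | succ l => exact ⟨m + 1 + (l + 1), concatAt_add h l⟩
    · exact ⟨j, if_pos hj⟩

end Excursions

/-! ### Markov property and the law of the excursions -/

section Laws

variable {d : ℕ}

/-- The law of the walk from the origin with independent steps of law `μ`. -/
noncomputable def stepLaw (μ : Measure (IntLattice d)) : Measure (Trajectory d) :=
  (Measure.infinitePi fun _ : ℕ => μ).map stepWalk

lemma ae_stepLaw_zero (μ : Measure (IntLattice d)) : ∀ᵐ s ∂stepLaw μ, s 0 = 0 := by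
  rw [stepLaw, ae_map_iff measurable_stepWalk.aemeasurable
    (measurableSet_setOfPred.2 (measurable_trajectory_apply_eq 0 0))]
  exact Eventually.of_forall fun ξ => by simp [stepWalk]

variable (μ : Measure (IntLattice d)) [IsProbabilityMeasure μ]

instance isProbabilityMeasure_stepLaw : IsProbabilityMeasure (stepLaw μ) :=
  Measure.isProbabilityMeasure_map measurable_stepWalk.aemeasurable

/-- The forward and the backward trajectory of independent two-sided steps are independent. -/
lemma map_twoSidedWalk : (Measure.infinitePi fun _ : ℤ => μ).map twoSidedWalk =
    (stepLaw μ).prod ((stepLaw μ).map fun s => -s) := by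
  rw [← infinitePi_sum_comp μ Equiv.intEquivNatSumNat.injective,
    Measure.map_map measurable_twoSidedWalk (measurable_sumElim_comp _), stepLaw,
    Measure.map_map measurable_neg measurable_stepWalk,
    Measure.map_prod_map _ _ measurable_stepWalk (measurable_neg.comp measurable_stepWalk)]
  rfl

/-- The Markov property at time `m`. -/
lemma map_concatAt (m : ℕ) : ((stepLaw μ).prod (stepLaw μ)).map (concatAt m) = stepLaw μ := by
  -- The spliced walk takes its first `m` steps from one sequence, then those of the other from its
  -- beginning.
  set f : ℕ → ℕ ⊕ ℕ := fun i => if i < m then Sum.inl i else Sum.inr (i - m) with hf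
  have hinj : Function.Injective f := by
    intro i j hij
    simp only [hf] at hij
    split_ifs at hij <;> simp at hij <;> omega
  have h : concatAt m ∘ Prod.map stepWalk stepWalk = stepWalk ∘
      fun (q : (ℕ → IntLattice d) × (ℕ → IntLattice d)) i => Sum.elim q.1 q.2 (f i) := by
    funext q
    have hsmall : ∀ j ≤ m, ∑ i ∈ Finset.range j, Sum.elim q.1 q.2 (f i) =
        ∑ i ∈ Finset.range j, q.1 i := fun j hj => by
      refine Finset.sum_congr rfl fun i hi => ?_
      rw [Finset.mem_range] at hi
      simp [hf, hi.trans_le hj]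
    funext j
    simp only [Function.comp_apply, concatAt, stepWalk, Prod.map_fst, Prod.map_snd]
    split_ifs with hj
    · exact (hsmall j hj).symm
    · obtain ⟨l, rfl⟩ := Nat.exists_eq_add_of_le (not_le.1 hj).le
      rw [Finset.sum_range_add, hsmall m le_rfl, Nat.add_sub_cancel_left]
      simp [hf]
  rw [stepLaw, Measure.map_prod_map _ _ measurable_stepWalk measurable_stepWalk,
    Measure.map_map (measurable_concatAt m) (measurable_stepWalk.prodMap measurable_stepWalk), h,
    ← Measure.map_map measurable_stepWalk (measurable_sumElim_comp f), infinitePi_sum_comp μ hinj]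

lemma measurePreserving_prod_left_comm {α β γ : Type*} [MeasurableSpace α] [MeasurableSpace β]
    [MeasurableSpace γ] (κ : Measure α) (ν : Measure β) (ρ : Measure γ) [SFinite κ] [SFinite ν]
    [SFinite ρ] : MeasurePreserving (fun x : α × β × γ => (x.2.1, x.1, x.2.2))
      (κ.prod (ν.prod ρ)) (ν.prod (κ.prod ρ)) := by
  have h1 := (measurePreserving_prodAssoc κ ν ρ).symm
  have h2 := (Measure.measurePreserving_swap (μ := κ) (ν := ν)).prod (MeasurePreserving.id ρ)
  have h3 := measurePreserving_prodAssoc ν κ ρ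
  exact h3.comp (h2.comp h1)

/-- The trajectories returning exactly `k` times to the origin that together with `G` do not cover
the neighbours of the origin. -/
def returnsNotCovered (k : ℕ) (G : Set (IntLattice d)) : Set (Trajectory d) :=
  {s | s ∈ returnsTotal d k ∧ ¬ neighbors (0 : IntLattice d) ⊆ Set.range s ∪ G}

/-- A final trajectory without return and `k` returning trajectories such that the final one, the
excursions of the others, and `G` do not cover the neighbours of the origin. -/
def excursionsNotCovered (k : ℕ) (G : Set (IntLattice d)) :
    Set (Trajectory d × (Fin k → Trajectory d)) :=
  {w | ¬ neighbors (0 : IntLattice d) ⊆ Set.range w.1 ∪ G ∪ ⋃ i, excursionRange (w.2 i) ∧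
    0 ∉ futureRange w.1 ∧ ∀ i, 0 ∈ futureRange (w.2 i)}

lemma measurable_mem_returnsNotCovered {α : Type*} [MeasurableSpace α] (k : ℕ)
    {f : α → Trajectory d} (hf : Measurable f) {G : α → Set (IntLattice d)}
    (hG : ∀ z, Measurable fun x => z ∈ G x) :
    Measurable fun x => f x ∈ returnsNotCovered k (G x) :=
  ((measurable_mem_returnsTotal k).comp hf).and
    (measurable_subset fun z => ((measurable_mem_range z).comp hf).or (hG z)).not

lemma measurable_mem_excursionsNotCovered {α : Type*} [MeasurableSpace α] (k : ℕ)
    {f : α → Trajectory d × (Fin k → Trajectory d)} (hf : Measurable f)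
    {G : α → Set (IntLattice d)} (hG : ∀ z, Measurable fun x => z ∈ G x) :
    Measurable fun x => f x ∈ excursionsNotCovered k (G x) := by
  have h2 : ∀ i, Measurable fun x => (f x).2 i := fun i =>
    (measurable_pi_apply i).comp (measurable_snd.comp hf)
  refine (measurable_subset fun z => ?_).not.and
    (((measurable_mem_futureRange 0).comp (measurable_fst.comp hf)).not.and
      (Measurable.forall fun i => (measurable_mem_futureRange 0).comp (h2 i)))
  refine (((measurable_mem_range z).comp (measurable_fst.comp hf)).or (hG z)).or ?_
  simp only [Set.mem_iUnion]
  exact Measurable.exists fun i => (measurable_mem_excursionRange z).comp (h2 i)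

/-- Decomposition at the first return to the origin. -/
lemma stepLaw_returnsNotCovered_succ (k : ℕ) (G : Set (IntLattice d)) :
    stepLaw μ (returnsNotCovered (k + 1) G) = ((stepLaw μ).prod (stepLaw μ))
      {w | 0 ∈ futureRange w.1 ∧ w.2 ∈ returnsNotCovered k (excursionRange w.1 ∪ G)} := by
  have hB : MeasurableSet (returnsNotCovered (k + 1) G) := measurableSet_setOfPred.2
    (measurable_mem_returnsNotCovered (k + 1) measurable_id fun _ => measurable_const)
  have hC : MeasurableSet {w : Trajectory d × Trajectory d |
      w.2 ∈ returnsNotCovered k (excursionRange w.1 ∪ G)} := measurableSet_setOfPred.2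
    (measurable_mem_returnsNotCovered k measurable_snd fun z =>
      ((measurable_mem_excursionRange z).comp measurable_fst).or measurable_const)
  have e1 : returnsNotCovered (k + 1) G =
      ⋃ m, firstReturn d m ∩ returnsNotCovered (k + 1) G := by
    rw [← Set.iUnion_inter, iUnion_firstReturn, eq_comm, Set.inter_eq_right]
    rintro s ⟨⟨K, hK⟩, -⟩
    rw [Set.mem_ofPred_eq, zero_mem_futureRange_iff]
    have := hK K le_rfl
    by_contra! h
    rw [(returns_eq_zero_iff s K).2 fun j _ => h j] at this
    omega
  have e2 : {w : Trajectory d × Trajectory d | 0 ∈ futureRange w.1 ∧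
      w.2 ∈ returnsNotCovered k (excursionRange w.1 ∪ G)} =
      ⋃ m, (Prod.fst ⁻¹' firstReturn d m) ∩
        {w | w.2 ∈ returnsNotCovered k (excursionRange w.1 ∪ G)} := by
    rw [← Set.iUnion_inter, ← Set.preimage_iUnion, iUnion_firstReturn]
    rfl
  rw [e1, e2, measure_iUnion, measure_iUnion]
  -- On each value of the first return time the Markov property is needed only at a fixed time.
  · refine tsum_congr fun m => ?_
    nth_rw 1 [← map_concatAt μ (m + 1)]
    rw [Measure.map_apply (measurable_concatAt _) ((measurableSet_firstReturn m).inter hB)]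
    -- The two events agree only almost surely, since `w.2` has to start at the origin.
    refine measure_congr ?_
    filter_upwards [Measure.quasiMeasurePreserving_snd.ae (ae_stepLaw_zero μ)] with w hw
    refine propext ?_
    change (concatAt (m + 1) w ∈ firstReturn d m ∧
      concatAt (m + 1) w ∈ returnsTotal d (k + 1) ∧ ¬ _) ↔
      w.1 ∈ firstReturn d m ∧ w.2 ∈ returnsTotal d k ∧ ¬ _
    rw [concatAt_mem_firstReturn_iff]
    refine and_congr_right fun h => ?_
    rw [concatAt_mem_returnsTotal_iff h, neighbors_subset_concatAt_iff h hw]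
  · exact fun m n hmn => ((pairwise_disjoint_firstReturn hmn).preimage Prod.fst).mono
      Set.inter_subset_left Set.inter_subset_left
  · exact fun m => (measurable_fst (measurableSet_firstReturn m)).inter hC
  · exact fun m n hmn => (pairwise_disjoint_firstReturn hmn).mono
      Set.inter_subset_left Set.inter_subset_left
  · exact fun m => (measurableSet_firstReturn m).inter hB

/-- A walk with exactly `k` returns to the origin is made of `k` independent excursions and of a
final walk without return. -/
lemma stepLaw_returnsNotCovered (k : ℕ) (G : Set (IntLattice d)) :
    stepLaw μ (returnsNotCovered k G) =
      ((stepLaw μ).prod (Measure.pi fun _ : Fin k => stepLaw μ)) (excursionsNotCovered k G) := by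
  -- `G` has to vary: the range of each excursion split off is added to it.
  induction k generalizing G with
  | zero =>
    have : excursionsNotCovered 0 G = returnsNotCovered 0 G ×ˢ Set.univ := by
      ext w
      simp [excursionsNotCovered, returnsNotCovered, mem_returnsTotal_zero_iff, and_comm]
    rw [this, Measure.prod_prod, measure_univ, mul_one]
  | succ k ih =>
    -- Moves the first excursion into slot `0` of the family, so that one can integrate over it last
    -- and apply the induction hypothesis with it fixed.
    have hΦ : MeasurePreserving (fun x : Trajectory d × Trajectory d × (Fin k → Trajectory d) =>
        (x.2.1, (Fin.cons x.1 x.2.2 : Fin (k + 1) → Trajectory d)))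
        ((stepLaw μ).prod ((stepLaw μ).prod (Measure.pi fun _ : Fin k => stepLaw μ)))
        ((stepLaw μ).prod (Measure.pi fun _ : Fin (k + 1) => stepLaw μ)) := by
      have hcons := (measurePreserving_piFinSuccAbove (fun _ : Fin (k + 1) => stepLaw μ) 0).symm
      have h := ((MeasurePreserving.id (stepLaw μ)).prod hcons).comp
        (measurePreserving_prod_left_comm (stepLaw μ) (stepLaw μ)
          (Measure.pi fun _ : Fin k => stepLaw μ))
      convert h using 1
      funext x
      simp [MeasurableEquiv.piFinSuccAbove, Fin.insertNthEquiv]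
    have hm1 : MeasurableSet (excursionsNotCovered (k + 1) G) := measurableSet_setOfPred.2
      (measurable_mem_excursionsNotCovered (k + 1) measurable_id fun _ => measurable_const)
    have hm2 : MeasurableSet {w : Trajectory d × Trajectory d | 0 ∈ futureRange w.1 ∧
        w.2 ∈ returnsNotCovered k (excursionRange w.1 ∪ G)} := measurableSet_setOfPred.2
      (((measurable_mem_futureRange 0).comp measurable_fst).and
        (measurable_mem_returnsNotCovered k measurable_snd fun z =>
          ((measurable_mem_excursionRange z).comp measurable_fst).or measurable_const))
    rw [stepLaw_returnsNotCovered_succ, ← hΦ.measure_preimage hm1.nullMeasurableSet,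
      Measure.prod_apply hm2, Measure.prod_apply (hΦ.measurable hm1)]
    refine lintegral_congr fun s => ?_
    have hmem : ∀ w : Trajectory d × (Fin k → Trajectory d),
        (w.1, (Fin.cons s w.2 : Fin (k + 1) → Trajectory d)) ∈ excursionsNotCovered (k + 1) G ↔
          0 ∈ futureRange s ∧ w ∈ excursionsNotCovered k (excursionRange s ∪ G) := by
      intro w
      have hU : Set.range w.1 ∪ G ∪ ⋃ i, excursionRange ((Fin.cons s w.2 : Fin (k + 1) → _) i) =
          Set.range w.1 ∪ (excursionRange s ∪ G) ∪ ⋃ i, excursionRange (w.2 i) := by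
        ext z
        simp only [Set.mem_union, Set.mem_iUnion, Fin.exists_fin_succ, Fin.cons_zero, Fin.cons_succ]
        tauto
      simp only [excursionsNotCovered, Set.mem_ofPred_eq, hU, Fin.forall_fin_succ, Fin.cons_zero,
        Fin.cons_succ]
      tauto
    by_cases hs : 0 ∈ futureRange s
    · have e1 : Prod.mk s ⁻¹' {w : Trajectory d × Trajectory d | 0 ∈ futureRange w.1 ∧
          w.2 ∈ returnsNotCovered k (excursionRange w.1 ∪ G)} =
          returnsNotCovered k (excursionRange s ∪ G) := by
        ext t
        simp [hs]
      rw [e1, ih]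
      congr 1
      ext w
      exact ((hmem w).trans (and_iff_right hs)).symm
    · have e1 : Prod.mk s ⁻¹' {w : Trajectory d × Trajectory d | 0 ∈ futureRange w.1 ∧
          w.2 ∈ returnsNotCovered k (excursionRange w.1 ∪ G)} = ∅ := by
        ext t
        simp [hs]
      rw [e1, measure_empty, eq_comm, ← measure_empty (μ := (stepLaw μ).prod
        (Measure.pi fun _ : Fin k => stepLaw μ))]
      congr 1
      ext w
      exact iff_of_false (fun h => hs ((hmem w).1 h).1) (Set.notMem_empty w)

/-- The law of a forward walk with exactly `k` returns and an independent backward trajectory. -/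
lemma prod_limit_eq_prod_excursions (k : ℕ) (ρ : Measure (Trajectory d)) [IsProbabilityMeasure ρ]
    {C : Set (Trajectory d)} (hC : MeasurableSet C) :
    ((stepLaw μ).prod ρ) {w | w ∈ limitAtLeast d k ∧ w.2 ∈ C} =
      ((stepLaw μ).prod (ρ.prod (Measure.pi fun _ : Fin k => stepLaw μ)))
        {w | w.2.1 ∈ C ∧ (w.1, w.2.2) ∈ excursionsNotCovered k (Set.range w.2.1)} := by
  have hm1 : MeasurableSet {w : Trajectory d × Trajectory d | w ∈ limitAtLeast d k ∧ w.2 ∈ C} :=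
    (measurableSet_limitAtLeast k).inter (measurable_snd hC)
  have hm2 : MeasurableSet {w : Trajectory d × Trajectory d × (Fin k → Trajectory d) |
      w.2.1 ∈ C ∧ (w.1, w.2.2) ∈ excursionsNotCovered k (Set.range w.2.1)} :=
    (measurable_fst.comp measurable_snd hC).inter (measurableSet_setOfPred.2
      (measurable_mem_excursionsNotCovered k
        (measurable_fst.prodMk (measurable_snd.comp measurable_snd))
        fun z => (measurable_mem_range z).comp (measurable_fst.comp measurable_snd)))
  have hΦ := measurePreserving_prod_left_comm ρ (stepLaw μ)
    (Measure.pi fun _ : Fin k => stepLaw μ)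
  rw [← hΦ.measure_preimage hm2.nullMeasurableSet, Measure.prod_apply_symm hm1,
    Measure.prod_apply (hΦ.measurable hm2)]
  -- With the backward path `s'` fixed, its range plays the role of `G`.
  refine lintegral_congr fun s' => ?_
  by_cases hs : s' ∈ C
  · have e1 : (fun s => (s, s')) ⁻¹' {w | w ∈ limitAtLeast d k ∧ w.2 ∈ C} =
        returnsNotCovered k (Set.range s') := by
      ext s
      simp [hs, limitAtLeast, returnsNotCovered]
    rw [e1, stepLaw_returnsNotCovered]
    congr 1
    ext w
    simp [hs]
  · have e1 : (fun s => (s, s')) ⁻¹' {w | w ∈ limitAtLeast d k ∧ w.2 ∈ C} = ∅ := by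
      ext s
      simp [hs]
    rw [e1, measure_empty, eq_comm, ← measure_empty (μ := (stepLaw μ).prod
      (Measure.pi fun _ : Fin k => stepLaw μ))]
    congr 1
    ext w
    simp [hs]

end Laws

/-! ### Transfer to the given walk -/

section Limit

variable {d : ℕ} {Ω : Type*} [MeasurableSpace Ω] {P : Measure Ω} [IsProbabilityMeasure P]
  {X : ℕ → Ω → IntLattice d}

lemma map_steps_eq_infinitePi (hmeas : ∀ i, Measurable (X i)) (hindep : iIndepFun X P)
    (hident : ∀ i, IdentDistrib (X i) (X 0) P P) :
    P.map (fun ω i => X i ω) = Measure.infinitePi fun _ : ℕ => P.map (X 0) := by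
  have := Measure.isProbabilityMeasure_map (μ := P) (hmeas 0).aemeasurable
  have h : ∀ i, IsProbabilityMeasure (P.map (X i)) := fun i =>
    Measure.isProbabilityMeasure_map (hmeas i).aemeasurable
  rw [hindep.map_fun_eq_infinitePi_map hmeas]
  congr 1
  funext i
  exact (hident i).map_eq

lemma walkLaw_eq_stepLaw (hmeas : ∀ i, Measurable (X i)) (hindep : iIndepFun X P)
    (hident : ∀ i, IdentDistrib (X i) (X 0) P P) : walkLaw P X = stepLaw (P.map (X 0)) := by
  rw [stepLaw, ← map_steps_eq_infinitePi hmeas hindep hident,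
    Measure.map_map measurable_stepWalk (measurable_pi_lambda _ hmeas), walkLaw]
  congr 1
  funext ω m
  simp [randomWalk, stepWalk]

lemma dualLaw_eq_map_stepLaw (hmeas : ∀ i, Measurable (X i)) (hindep : iIndepFun X P)
    (hident : ∀ i, IdentDistrib (X i) (X 0) P P) :
    dualLaw P X = (stepLaw (P.map (X 0))).map fun s => -s := by
  rw [stepLaw, ← map_steps_eq_infinitePi hmeas hindep hident,
    Measure.map_map measurable_stepWalk (measurable_pi_lambda _ hmeas),
    Measure.map_map measurable_neg
      (measurable_stepWalk.comp (measurable_pi_lambda _ hmeas)), dualLaw]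
  congr 1
  funext ω m
  simp [randomWalk, stepWalk]

/-- The probability of a limit event for the two-sided walk, in terms of the joint law of the
walk, the dual walk and `k` excursions. -/
lemma measureReal_preimage_twoSidedWalk (hmeas : ∀ i, Measurable (X i)) (hindep : iIndepFun X P)
    (hident : ∀ i, IdentDistrib (X i) (X 0) P P) (k : ℕ) {C : Set (Trajectory d)}
    (hC : MeasurableSet C) :
    (Measure.infinitePi fun _ : ℤ => P.map (X 0)).real
      (twoSidedWalk ⁻¹' {w | w ∈ limitAtLeast d k ∧ w.2 ∈ C}) =
    (jointLaw P X k).real {w | w.2.1 ∈ C ∧ w ∈ atLeastEvent d k} := by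
  have := Measure.isProbabilityMeasure_map (μ := P) (hmeas 0).aemeasurable
  have := Measure.isProbabilityMeasure_map (μ := stepLaw (P.map (X 0)))
    (measurable_neg (G := Trajectory d)).aemeasurable
  have hm : MeasurableSet {w : Trajectory d × Trajectory d | w ∈ limitAtLeast d k ∧ w.2 ∈ C} :=
    (measurableSet_limitAtLeast k).inter (measurable_snd hC)
  rw [measureReal_def, measureReal_def, ← Measure.map_apply measurable_twoSidedWalk hm,
    map_twoSidedWalk,
    prod_limit_eq_prod_excursions _ k _ hC, jointLaw, walkLaw_eq_stepLaw hmeas hindep hident,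
    dualLaw_eq_map_stepLaw hmeas hindep hident]
  rfl

/-- If the count `N s n` is the number of times at which a window event occurs, then its
frequency converges along almost every path of the walk. -/
lemma ae_tendsto_count_div (hmeas : ∀ i, Measurable (X i)) (hindep : iIndepFun X P)
    (hident : ∀ i, IdentDistrib (X i) (X 0) P P) (a : IntLattice d)
    {N : Trajectory d → ℕ → ℕ} {W : ℕ → ℕ → Set (Trajectory d × Trajectory d)}
    {L : Set (Trajectory d × Trajectory d)} (hW : ∀ u v, MeasurableSet (W u v))
    (hL : MeasurableSet L)
    (hWL : ∀ w, ∃ K, ∀ u v, K ≤ u → K ≤ v → (w ∈ W u v ↔ w ∈ L))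
    (hN : ∀ (ω : ℤ → IntLattice d) n, N (fun m => a + stepWalk (fun j => ω j) m) n =
      (open Classical in ((Finset.range (n + 1)).filter fun i =>
        intShift^[i] ω ∈ twoSidedWalk ⁻¹' W (n - i) i).card)) :
    ∀ᵐ ω ∂P, Tendsto (fun n : ℕ => (N (randomWalk a X ω) n : ℝ) / n) atTop
      (𝓝 ((Measure.infinitePi fun _ : ℤ => P.map (X 0)).real (twoSidedWalk ⁻¹' L))) := by
  classical
  have := Measure.isProbabilityMeasure_map (μ := P) (hmeas 0).aemeasurable
  set μ := P.map (X 0)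
  set c := (Measure.infinitePi fun _ : ℤ => μ).real (twoSidedWalk ⁻¹' L)
  have hT := measurePreserving_intShift μ
  have h := ae_tendsto_card_window_div (ergodic_intShift μ)
    (fun u v => measurable_twoSidedWalk (hW u v)) (measurable_twoSidedWalk hL)
    (fun ω => hWL (twoSidedWalk ω))
  simp only [← hN] at h
  -- An arbitrary measurable extension to `ℤ`: the count ignores negative coordinates, so this makes
  -- it measurable in the one-sided steps. The convergence set is then measurable, and the almost
  -- sure statement passes to the one-sided marginal.
  set ext : (ℕ → IntLattice d) → ℤ → IntLattice d := fun ξ i => ξ i.toNat with hext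
  have hextm : Measurable ext := measurable_pi_lambda _ fun i => measurable_pi_apply _
  have hNm : ∀ n, Measurable fun ξ : ℕ → IntLattice d =>
      (N (fun m => a + stepWalk ξ m) n : ℝ) / n := by
    intro n
    have e : ∀ ξ : ℕ → IntLattice d, N (fun m => a + stepWalk ξ m) n =
        ∑ i ∈ Finset.range (n + 1),
          if intShift^[i] (ext ξ) ∈ twoSidedWalk ⁻¹' W (n - i) i then 1 else 0 := by
      intro ξ
      rw [← Finset.card_filter, ← hN (ext ξ) n]
      simp [hext]
    simp only [e, Nat.cast_sum]
    refine (Finset.measurable_sum _ fun i _ => ?_).div_const _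
    refine (measurable_from_nat (f := fun m : ℕ => (m : ℝ))).comp
      (Measurable.ite ?_ measurable_const measurable_const)
    exact ((hT.measurable.iterate i).comp hextm) (measurable_twoSidedWalk (hW _ _))
  have hG : MeasurableSet {ξ : ℕ → IntLattice d |
      Tendsto (fun n : ℕ => (N (fun m => a + stepWalk ξ m) n : ℝ) / n) atTop (𝓝 c)} :=
    measurableSet_tendsto (𝓝 c) hNm
  have hrm : Measurable fun (ω : ℤ → IntLattice d) (j : ℕ) => ω j :=
    measurable_pi_lambda _ fun _ => measurable_pi_apply _
  have hrestr : (Measure.infinitePi fun _ : ℤ => μ).map (fun ω (j : ℕ) => ω j) =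
      Measure.infinitePi fun _ : ℕ => μ :=
    Measure.map_infinitePi_infinitePi_of_inj (P := fun _ : ℤ => μ) Nat.cast_injective
  have h2 : ∀ᵐ ξ ∂(P.map fun ω i => X i ω),
      Tendsto (fun n : ℕ => (N (fun m => a + stepWalk ξ m) n : ℝ) / n) atTop (𝓝 c) := by
    rw [map_steps_eq_infinitePi hmeas hindep hident, ← hrestr,
      ae_map_iff hrm.aemeasurable hG]
    exact h
  exact ae_of_ae_map (measurable_pi_lambda _ hmeas).aemeasurable h2

end Limit

theorem theorem2 {d : ℕ} (hd : 1 ≤ d) {Ω : Type*} [MeasurableSpace Ω] (P : Measure Ω)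
    [IsProbabilityMeasure P] (X : ℕ → Ω → IntLattice d) (hmeas : ∀ i, Measurable (X i))
    (hindep : iIndepFun X P) (hident : ∀ i, IdentDistrib (X i) (X 0) P P)
    (a : IntLattice d) (p : ℕ) (hp : 1 ≤ p) :
    (∀ᵐ ω ∂P, Tendsto (fun n : ℕ => (countExactly (randomWalk a X ω) p n : ℝ) / (n : ℝ)) atTop
      (𝓝 ((jointLaw P X (p - 1)).real (exactEvent d (p - 1))))) ∧
    (∀ᵐ ω ∂P, Tendsto (fun n : ℕ => (countAtLeast (randomWalk a X ω) p n : ℝ) / (n : ℝ)) atTop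
      (𝓝 ((jointLaw P X (p - 1)).real (atLeastEvent d (p - 1))))) := by
  obtain ⟨k, rfl⟩ := Nat.exists_eq_add_of_le' hp
  rw [Nat.add_sub_cancel]
  constructor
  -- The exact count adds only that the dual walk never returns, which is the choice of `C`; the
  -- other count takes `C` to be everything.
  · have e := measureReal_preimage_twoSidedWalk hmeas hindep hident k
      (C := {s | 0 ∉ futureRange s}) (measurableSet_setOfPred.2 (measurable_mem_futureRange 0).not)
    have h := ae_tendsto_count_div hmeas hindep hident a
      (N := fun s n => countExactly s (k + 1) n) (measurableSet_windowExactly k)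
      (measurableSet_limitExactly k) (exists_mem_windowExactly_iff k)
      (fun ω n => countExactly_eq_card a ω k n)
    have hev : exactEvent d k = {w | w.2.1 ∈ {s | 0 ∉ futureRange s} ∧ w ∈ atLeastEvent d k} := by
      ext w
      simp only [exactEvent, atLeastEvent, Set.mem_ofPred_eq, Set.mem_union, not_or]
      tauto
    rw [hev, ← e]
    exact h
  · have e := measureReal_preimage_twoSidedWalk hmeas hindep hident k MeasurableSet.univ
    have h := ae_tendsto_count_div hmeas hindep hident a
      (N := fun s n => countAtLeast s (k + 1) n) (measurableSet_windowAtLeast k)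
      (measurableSet_limitAtLeast k) (exists_mem_windowAtLeast_iff k)
      (fun ω n => countAtLeast_eq_card a ω k n)
    simp only [Set.mem_univ, and_true, true_and] at e
    rw [← Set.ofPred_mem_eq (s := atLeastEvent d k), ← e]
    exact h
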